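/- Write $\mathbb{N}=\{1,2,\ldots\}$. A function $f:\mathbb{N}\to\mathbb{C}$ is additive if $f(mn)=f(m)+f(n)$ for all coprime $m,n\in\mathbb{N}$. Let ${\cal F}_1$ be the class of additive functions $f:\mathbb{N}\to\mathbb{C}$ such that $f(p)=p$ for every prime $p$ and such that, for some integer $\ell\ge 0$, $f(p^{\nu})\ll \nu^{\ell}p^{\nu}$ uniformly for the primes $p$ and the integers $\nu\ge 2$. Let $(n_1,\ldots,n_k)$ denote the greatest common divisor of $n_1,\ldots,n_k$, let $\gamma$ be Euler's constant, let $\sum_p$ denote summation over all primes, and let $n_1,\ldots,n_k$ run over the positive integers not exceeding the real number $x$. Let $f\in{\cal F}_1$. Then, as $x\to\infty$, $$\sum_{n_1,n_2\le x} f((n_1,n_2)) = x^2\log\log x + \overline{D}_{f,2}\,x^2 + O\left(\frac{x^2}{\log x}\right),$$ where $$\overline{D}_{f,2} = \gamma + \sum_p\left(\log\left(1-\frac1p\right)+\left(1-\frac1{p^2}\right)\sum_{\nu=1}^{\infty}\frac{f(p^{\nu})}{p^{2\nu}}\right),$$ and, for every integer $k\ge 3$, $$\sum_{n_1,\ldots,n_k\le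 x} f((n_1,\ldots,n_k)) = D_{f,k}\,x^k + \begin{cases} O(x^{k-1}), & \text{if } k\ge 4,\\ O(x^2\log\log x), & \text{if } k=3,\end{cases}$$ where $$D_{f,k} = \sum_p\left(1-\frac1{p^k}\right)\sum_{\nu=1}^{\infty}\frac{f(p^{\nu})}{p^{\nu k}}.$$ Here the series over $\nu$ (for every prime $p$ and every $k\ge2$) and the series over $p$ converge absolutely, and the implied constants may depend on $f$ and $k$. -/

import Mathlib

open scoped Asymptotics

/-- Additive arithmetic functions `f : {1, 2, …} → ℂ`. The value `f 0` is irrelevant. -/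
def IsAdditiveArith (f : ℕ → ℂ) : Prop :=
  ∀ m n : ℕ, 1 ≤ m → 1 ≤ n → Nat.Coprime m n → f (m * n) = f m + f n

/-- The class of Alladi–Erdős-type functions: additive functions with `f p = p` for every prime `p`
and, for some `ℓ ∈ {0, 1, 2, …}`, `f (p ^ ν) ≪ ν ^ ℓ * p ^ ν` uniformly in the primes `p` and
the integers `ν ≥ 2`. -/
structure IsAlladiErdosType (f : ℕ → ℂ) : Prop where
  additive : IsAdditiveArith f
  map_prime : ∀ p : ℕ, p.Prime → f p = (p : ℂ)
  bound : ∃ (l : ℕ) (C : ℝ), ∀ p : ℕ, p.Prime → ∀ v : ℕ, 2 ≤ v →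
    ‖f (p ^ v)‖ ≤ C * ((v : ℝ) ^ l * (p : ℝ) ^ v)

/-- The sum of `f (gcd (n₁, …, n_k))` over all positive integers `n₁, …, n_k ≤ x`. -/
noncomputable def gcdSum (f : ℕ → ℂ) (k : ℕ) (x : ℝ) : ℂ :=
  ∑ n ∈ Fintype.piFinset (fun _ : Fin k => Finset.Icc 1 ⌊x⌋₊), f (Finset.univ.gcd n)

/-- The `ν`-th term, `ν = i + 1 ≥ 1`, of the series `∑_{ν ≥ 1} f (p ^ ν) / p ^ (ν k)`. -/
noncomputable def primePowTerm (f : ℕ → ℂ) (k p i : ℕ) : ℂ :=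
  f (p ^ (i + 1)) / (p : ℂ) ^ ((i + 1) * k)

/-- `(1 - 1 / p ^ k) ∑_{ν ≥ 1} f (p ^ ν) / p ^ (ν k)`. -/
noncomputable def localTerm (f : ℕ → ℂ) (k p : ℕ) : ℂ :=
  (1 - 1 / (p : ℂ) ^ k) * ∑' i : ℕ, primePowTerm f k p i

/-- `log (1 - 1 / p) + (1 - 1 / p ^ 2) ∑_{ν ≥ 1} f (p ^ ν) / p ^ (2 ν)`. -/
noncomputable def localTermTwo (f : ℕ → ℂ) (p : ℕ) : ℂ :=
  ((Real.log (1 - 1 / (p : ℝ)) : ℝ) : ℂ) + localTerm f 2 p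

/-- The constant `∑_p (1 - 1 / p ^ k) ∑_{ν ≥ 1} f (p ^ ν) / p ^ (ν k)` (used for `k ≥ 3`). -/
noncomputable def gcdConst (f : ℕ → ℂ) (k : ℕ) : ℂ :=
  ∑' p : Nat.Primes, localTerm f k p

/-- The constant for `k = 2`, namely
`γ + ∑_p (log (1 - 1 / p) + (1 - 1 / p ^ 2) ∑_{ν ≥ 1} f (p ^ ν) / p ^ (2 ν))`. -/
noncomputable def gcdConstTwo (f : ℕ → ℂ) : ℂ :=
  (Real.eulerMascheroniConstant : ℂ) + ∑' p : Nat.Primes, localTermTwo f p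

/-! Since `f 1 = 0`, telescoping along the powers of each prime writes an additive `f n` as the sum
of the increments f(q) - f(q/p) over the prime powers q = p^ν dividing n. A prime power divides a
gcd exactly when it divides every entry, so the sum over k-tuples is exactly ∑ (f(q) - f(q/p))
⌊x/q⌋^k over all prime powers q. Replacing ⌊x/q⌋ by x/q gives the main term, and summation by parts
in ν turns its coefficient into (1 - p^(-k)) ∑ f(p^ν) p^(-νk). It remains to control the error.

For ν ≥ 2 the increment is O(ν^l q), and such q are sparse: ∑ ν^l q^(1-τ) converges for τ > 3/2. The
error is therefore O(x^τ) with τ = 7/4 for k = 2 and τ = k - 1 for k ≥ 3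
(`norm_tsum_floor_pow_sub_le`).

For ν = 1 the increment is p and k decides. If k ≥ 4, ∑ p^(2-k) converges and the error is
O(x^(k-1)). If k = 3, cutting at p ≤ x costs O(x² ∑ 1/p) = O(x² log log x), and the tail of ∑ 1/p²
costs O(x²). If k = 2, the sum is x² ∑_{p ≤ x} 1/p + O(x π(x)), so Chebyshev's bound and Mertens'
second theorem with its constant are needed.

Mertens' theorem is proved from the first theorem by partial summation, which gives ∑ Λ(m)/(m log m)
= log log n + M + O(1/log n). An Abelian argument, comparing log ζ(1 + s) with -log(1 - e^(-s)) as s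
→ 0+, gives M = γ (`logZetaPartialError_limit_eq`). Removing the proper prime powers then adds ∑
(log(1 - 1/p) + 1/p). -/

/-! ### Mertens' first theorem and partial summation. -/

section Mertens

open Real Finset Filter Topology MeasureTheory
open ArithmeticFunction (vonMangoldt)
open scoped ArithmeticFunction.vonMangoldt

/-- The difference `∑_{m ≤ n} Λ(m) / m - log n`, bounded by Mertens' first theorem. -/
noncomputable def mertensFirstError (n : ℕ) : ℝ := ∑ m ∈ Ioc 0 n, Λ m / m - log n

theorem sum_vonMangoldt_mul_div_eq_log_factorial (n : ℕ) :
    ∑ m ∈ Ioc 0 n, Λ m * ((n / m : ℕ) : ℝ) = log (n.factorial : ℝ) := by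
  rw [← ArithmeticFunction.sum_Ioc_mul_zeta_eq_sum, ArithmeticFunction.vonMangoldt_mul_zeta]
  induction n with
  | zero => simp
  | succ n ih =>
    rw [← Finset.insert_Ioc_right_eq_Ioc_add_one (Nat.zero_le n), sum_insert (by simp), ih, Nat.factorial_succ]
    push_cast
    rw [log_mul (by positivity) (by positivity)]
    simp

/-- Compare log n! = ∑ Λ(m) ⌊n/m⌋ = n log n + O(n) with n ∑ Λ(m)/m: dropping the floors costs at
most ψ(n) = O(n). -/
theorem exists_abs_mertensFirstError_le :
    ∃ C : ℝ, 0 ≤ C ∧ ∀ n : ℕ, 1 ≤ n → |mertensFirstError n| ≤ C := by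
  -- The bound for ψ gives log 4 + 4 from above, the lower bound for log n! gives 1 from below; the
  -- sum serves both sides.
  refine ⟨log 4 + 5, by positivity, fun n hn => ?_⟩
  have hn0 : (0 : ℝ) < n := by exact_mod_cast hn
  have h1 := sum_vonMangoldt_mul_div_eq_log_factorial n
  have h2 : log (n.factorial : ℝ) ≤ n * log n := by
    rw [← log_pow]
    gcongr
    exact_mod_cast Nat.factorial_le_pow n
  have h3 : n * log n - n ≤ log (n.factorial : ℝ) := by
    have := Stirling.le_log_factorial_stirling (n := n) (by omega)
    have h4 : 0 ≤ log (n : ℝ) := log_nonneg (by exact_mod_cast hn)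
    have h5 : 0 ≤ log (2 * π) := log_nonneg (by nlinarith [pi_gt_three])
    linarith
  have hpsi : ∑ m ∈ Ioc 0 n, Λ m ≤ (log 4 + 4) * n := by
    have := Chebyshev.psi_le_const_mul_self (x := (n : ℝ)) hn0.le
    simpa [Chebyshev.psi] using this
  have hup : ∑ m ∈ Ioc 0 n, Λ m * ((n / m : ℕ) : ℝ) ≤ n * ∑ m ∈ Ioc 0 n, Λ m / m := by
    rw [mul_sum]
    refine sum_le_sum fun m hm => ?_
    have : ((n / m : ℕ) : ℝ) ≤ n / m := Nat.cast_div_le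
    calc Λ m * ((n / m : ℕ) : ℝ) ≤ Λ m * (n / m) :=
          mul_le_mul_of_nonneg_left this ArithmeticFunction.vonMangoldt_nonneg
      _ = n * (Λ m / m) := by ring
  have hlo : n * ∑ m ∈ Ioc 0 n, Λ m / m ≤
      ∑ m ∈ Ioc 0 n, Λ m * ((n / m : ℕ) : ℝ) + ∑ m ∈ Ioc 0 n, Λ m := by
    rw [mul_sum, ← sum_add_distrib]
    refine sum_le_sum fun m hm => ?_
    have : (n : ℝ) / m ≤ ((n / m : ℕ) : ℝ) + 1 := by
      rw [← Nat.floor_div_eq_div (K := ℝ)]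
      exact (Nat.lt_floor_add_one _).le
    calc n * (Λ m / m) = Λ m * (n / m) := by ring
      _ ≤ Λ m * (((n / m : ℕ) : ℝ) + 1) :=
          mul_le_mul_of_nonneg_left this ArithmeticFunction.vonMangoldt_nonneg
      _ = _ := by ring
  rw [mertensFirstError]
  set T := ∑ m ∈ Ioc 0 n, Λ m / m
  have hl4 : 0 ≤ log (4 : ℝ) := log_nonneg (by norm_num)
  rw [abs_le]
  constructor
  · have : 0 ≤ n * (T - log n + (log 4 + 5)) := by nlinarith
    have := nonneg_of_mul_nonneg_right this hn0
    linarith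
  · have : 0 ≤ n * ((log 4 + 5) - (T - log n)) := by nlinarith
    have := nonneg_of_mul_nonneg_right this hn0
    linarith

/-- The coefficients `Λ(n) / (n log n)` of `log ζ(1)`. -/
noncomputable def logZetaCoeff (n : ℕ) : ℝ := Λ n / (n * log n)

theorem logZetaCoeff_nonneg (n : ℕ) : 0 ≤ logZetaCoeff n :=
  div_nonneg ArithmeticFunction.vonMangoldt_nonneg
    (mul_nonneg (Nat.cast_nonneg _) (log_natCast_nonneg n))

/-- The difference `∑_{m ≤ n} Λ(m) / (m log m) - log log n`. -/
noncomputable def logZetaPartialError (n : ℕ) : ℝ :=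
  ∑ m ∈ Ioc 0 n, logZetaCoeff m - log (log n)

/-- A discrete form of d(log log t) = d(log t) / log t, with an error chosen to telescope. -/
theorem log_log_succ_sub_le {n : ℕ} (hn : 2 ≤ n) :
    |(log (n + 1) - log n) / log (n + 1) - (log (log (n + 1)) - log (log n))| ≤
      1 / log n - 1 / log (n + 1) := by
  have h2 : (2 : ℝ) ≤ n := by exact_mod_cast hn
  have hl : 0 < log (n : ℝ) := log_pos (by linarith)
  have hlt : log (n : ℝ) < log (n + 1) := log_lt_log (by linarith) (by linarith)
  have hl' : 0 < log ((n : ℝ) + 1) := hl.trans hlt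
  have hd : log ((n : ℝ) + 1) - log n ≤ 1 := by
    rw [← log_div (by positivity) (by positivity)]
    have := log_le_sub_one_of_pos (x := ((n : ℝ) + 1) / n) (by positivity)
    have h3 : ((n : ℝ) + 1) / n - 1 = 1 / n := by field_simp; ring
    have h4 : 1 / (n : ℝ) ≤ 1 := by rw [div_le_one (by linarith)]; linarith
    linarith
  set a := log (n : ℝ)
  set b := log ((n : ℝ) + 1)
  have u1 : log b - log a ≤ (b - a) / a := by
    rw [← log_div hl'.ne' hl.ne']
    have := log_le_sub_one_of_pos (x := b / a) (by positivity)
    have h3 : b / a - 1 = (b - a) / a := by field_simp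
    linarith
  have u2 : (b - a) / b ≤ log b - log a := by
    have := log_le_sub_one_of_pos (x := a / b) (by positivity)
    rw [log_div hl.ne' hl'.ne'] at this
    have h3 : a / b - 1 = -((b - a) / b) := by field_simp; ring
    linarith
  have u3 : (b - a) / a - (b - a) / b ≤ 1 / a - 1 / b := by
    have : 1 / b ≤ 1 / a := one_div_le_one_div_of_le hl hlt.le
    have e : (b - a) / a - (b - a) / b = (b - a) * (1 / a - 1 / b) := by ring
    rw [e]
    nlinarith
  rw [abs_le]
  constructor <;> linarith

/-- Abel summation done as an induction: after the boundary terms are removed, each step adds the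
first Mertens error times 1/log n - 1/log(n+1), which gives C, and the log log discrepancy, which
gives the extra 1. -/
theorem abs_logZetaPartialError_sub_le {C : ℝ}
    (hC : ∀ n : ℕ, 1 ≤ n → |mertensFirstError n| ≤ C) {m : ℕ} (hm : 2 ≤ m) (n : ℕ) (hmn : m ≤ n) :
    |logZetaPartialError n - logZetaPartialError m - mertensFirstError n / log n +
      mertensFirstError m / log m| ≤ (C + 1) * (1 / log m - 1 / log n) := by
  induction n, hmn using Nat.le_induction with
  | base => simp
  | succ n hmn ih =>
    have h2n : 2 ≤ n := hm.trans hmn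
    have h2 : (2 : ℝ) ≤ n := by exact_mod_cast h2n
    have hl : 0 < log (n : ℝ) := log_pos (by linarith)
    have hlt : log (n : ℝ) < log (n + 1) := log_lt_log (by linarith) (by linarith)
    have hl' : 0 < log ((n : ℝ) + 1) := hl.trans hlt
    have hR := hC n (by omega)
    have key := log_log_succ_sub_le h2n
    have e1 : logZetaPartialError (n + 1) = logZetaPartialError n +
        (Λ (n + 1) / ((n : ℝ) + 1)) / log (n + 1) - (log (log (n + 1)) - log (log n)) := by
      simp only [logZetaPartialError]
      rw [← Finset.insert_Ioc_right_eq_Ioc_add_one (Nat.zero_le n), sum_insert (by simp)]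
      simp only [logZetaCoeff]
      push_cast
      rw [div_div]; ring
    have e2 : mertensFirstError (n + 1) = mertensFirstError n + Λ (n + 1) / ((n : ℝ) + 1) -
        (log (n + 1) - log n) := by
      simp only [mertensFirstError]
      rw [← Finset.insert_Ioc_right_eq_Ioc_add_one (Nat.zero_le n), sum_insert (by simp)]
      push_cast
      ring
    have e3 : Λ (n + 1) / ((n : ℝ) + 1) = mertensFirstError (n + 1) - mertensFirstError n +
        (log (n + 1) - log n) := by rw [e2]; ring
    rw [e3] at e1
    rw [e1]
    push_cast
    have hdiff : 0 ≤ 1 / log (n : ℝ) - 1 / log (n + 1) := by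
      have := one_div_le_one_div_of_le hl hlt.le
      linarith
    have hRb : |mertensFirstError n * (1 / log (n : ℝ) - 1 / log (n + 1))| ≤
        C * (1 / log (n : ℝ) - 1 / log (n + 1)) := by
      rw [abs_mul, abs_of_nonneg hdiff]
      exact mul_le_mul_of_nonneg_right hR hdiff
    have e4 : logZetaPartialError n + (mertensFirstError (n + 1) - mertensFirstError n +
        (log (n + 1) - log n)) / log (n + 1) - (log (log (n + 1)) - log (log n)) -
        logZetaPartialError m - mertensFirstError (n + 1) / log (n + 1) +
        mertensFirstError m / log m =
        (logZetaPartialError n - logZetaPartialError m - mertensFirstError n / log n +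
          mertensFirstError m / log m) +
        mertensFirstError n * (1 / log (n : ℝ) - 1 / log (n + 1)) +
        ((log (n + 1) - log n) / log (n + 1) - (log (log (n + 1)) - log (log n))) := by ring
    rw [e4]
    refine (abs_add_three _ _ _).trans ?_
    linarith

/-- Boundary terms and telescoped sum are all O(1/log m), uniformly in n ≥ m. The sequence is thus
Cauchy, and letting n → ∞ keeps the rate. -/
theorem exists_abs_logZetaPartialError_sub_le :
    ∃ M K : ℝ, 0 ≤ K ∧ ∀ n : ℕ, 2 ≤ n → |logZetaPartialError n - M| ≤ K / log n := by
  obtain ⟨C, hC0, hC⟩ := exists_abs_mertensFirstError_le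
  have hlog : Tendsto (fun n : ℕ => log (n : ℝ)) atTop atTop :=
    tendsto_log_atTop.comp tendsto_natCast_atTop_atTop
  have main : ∀ m : ℕ, 2 ≤ m → ∀ n, m ≤ n →
      |logZetaPartialError n - logZetaPartialError m| ≤ (3 * C + 1) / log m := by
    intro m hm n hmn
    have h2 : (2 : ℝ) ≤ m := by exact_mod_cast hm
    have hl : 0 < log (m : ℝ) := log_pos (by linarith)
    have hle : log (m : ℝ) ≤ log n := log_le_log (by linarith) (by exact_mod_cast hmn)
    have hl' := hl.trans_le hle
    have h := abs_logZetaPartialError_sub_le hC hm n hmn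
    have b1 : |mertensFirstError n / log n| ≤ C / log m := by
      rw [abs_div, abs_of_pos hl']
      exact div_le_div₀ hC0 (hC n (by omega)) hl hle
    have b2 : |mertensFirstError m / log m| ≤ C / log m := by
      rw [abs_div, abs_of_pos hl]
      exact div_le_div_of_nonneg_right (hC m (by omega)) hl.le
    have b3 : (C + 1) * (1 / log (m : ℝ) - 1 / log n) ≤ (C + 1) / log m := by
      have : 0 ≤ 1 / log (n : ℝ) := by positivity
      have : (C + 1) / log (m : ℝ) = (C + 1) * (1 / log m) := by ring
      rw [this]
      apply mul_le_mul_of_nonneg_left _ (by linarith)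
      linarith
    have e : logZetaPartialError n - logZetaPartialError m =
      (logZetaPartialError n - logZetaPartialError m - mertensFirstError n / log n +
      mertensFirstError m / log m) + mertensFirstError n / log n +
      -(mertensFirstError m / log m) := by ring
    rw [e]
    refine (abs_add_three _ _ _).trans ?_
    rw [abs_neg]
    have : (3 * C + 1) / log (m : ℝ) = (C + 1) / log m + C / log m + C / log m := by ring
    linarith
  have hcau : CauchySeq logZetaPartialError := by
    rw [Metric.cauchySeq_iff']
    intro ε hε
    have ht : Tendsto (fun n : ℕ => (3 * C + 1) / log (n : ℝ)) atTop (𝓝 0) :=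
      hlog.const_div_atTop _
    obtain ⟨N, hN2, hN⟩ := ((eventually_ge_atTop 2).and (ht.eventually_lt_const hε)).exists
    exact ⟨N, fun n hn => (main N hN2 n hn).trans_lt hN⟩
  obtain ⟨M, hM⟩ := cauchySeq_tendsto_of_complete hcau
  refine ⟨M, 3 * C + 1, by linarith, fun m hm => ?_⟩
  rw [abs_sub_comm]
  refine le_of_tendsto ((hM.sub_const _).abs) ?_
  filter_upwards [eventually_ge_atTop m] with n hn using main m hm n hn

end Mertens

/-! ### The constant is Euler's: an Abelian argument at the pole of ζ. -/

section MertensConstant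

open Real Finset Filter Topology MeasureTheory
open ArithmeticFunction (vonMangoldt)
open scoped ArithmeticFunction.vonMangoldt

theorem integrable_indicator_Ici_exp_neg (a l : ℝ) :
    Integrable (fun v : ℝ => if l ≤ v then a * exp (-v) else 0) (volume.restrict (Set.Ioi 0)) := by
  have h : Integrable (fun v : ℝ => a * exp (-v)) (volume.restrict (Set.Ioi 0)) := by
    have := (integrableOn_exp_neg_Ioi 0).const_mul a
    exact this
  have := h.indicator (measurableSet_Ici (a := l))
  refine this.congr (Eventually.of_forall fun v => ?_)
  simp [Set.indicator_apply]

theorem integral_indicator_Ici_exp_neg (a : ℝ) {l : ℝ} (hl : 0 ≤ l) :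
    ∫ v in Set.Ioi 0, (if l ≤ v then a * exp (-v) else 0) = a * exp (-l) := by
  have : (fun v : ℝ => if l ≤ v then a * exp (-v) else 0) =
      (Set.Ici l).indicator (fun v => a * exp (-v)) := by
    ext v; simp [Set.indicator_apply]
  rw [← integral_Ici_eq_integral_Ioi, this, setIntegral_indicator measurableSet_Ici,
    Set.inter_eq_right.2 (Set.Ici_subset_Ici.2 hl), integral_Ici_eq_integral_Ioi,
    integral_const_mul, integral_exp_neg_Ioi]

theorem integral_norm_indicator_Ici_exp_neg (a : ℝ) {l : ℝ} (hl : 0 ≤ l) :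
    ∫ v in Set.Ioi 0, ‖(if l ≤ v then a * exp (-v) else 0)‖ = |a| * exp (-l) := by
  rw [← integral_indicator_Ici_exp_neg |a| hl]
  congr 1; ext v
  split_ifs <;> simp

/-- The difference `∑_{n ≤ eᵗ} Λ(n) / (n log n) - ∑_{n ≤ t} 1 / n`. -/
noncomputable def logZetaSubHarmonic (t : ℝ) : ℝ :=
  ∑ n ∈ Ioc 0 ⌊exp t⌋₊, logZetaCoeff n - ∑ n ∈ Ioc 0 ⌊t⌋₊, 1 / (n : ℝ)

theorem summable_logZetaCoeff_mul {s : ℝ} (hs : 0 < s) :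
    Summable (fun n : ℕ => logZetaCoeff n * exp (-(s * log n))) := by
  have h1 : Summable (fun n : ℕ => 1 / (n : ℝ) ^ (1 + s)) :=
    summable_one_div_nat_rpow.2 (by linarith)
  refine h1.of_nonneg_of_le (fun n => mul_nonneg (logZetaCoeff_nonneg n) (exp_pos _).le) fun n => ?_
  rcases Nat.lt_or_ge n 2 with hn | hn
  · interval_cases n <;> simp [logZetaCoeff]
    positivity
  · have h2 : (2 : ℝ) ≤ n := by exact_mod_cast hn
    have hl : 0 < log (n : ℝ) := log_pos (by linarith)
    have hn0 : (0 : ℝ) < n := by linarith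
    have : exp (-(s * log n)) = 1 / (n : ℝ) ^ s := by
      rw [rpow_def_of_pos hn0, one_div, ← exp_neg]; ring_nf
    rw [this, rpow_add hn0, rpow_one, logZetaCoeff, div_mul_div_comm, mul_one]
    have hp : 0 < (n : ℝ) ^ s := rpow_pos_of_pos hn0 s
    rw [div_le_div_iff₀ (by positivity) (by positivity)]
    have := ArithmeticFunction.vonMangoldt_le_log (n := n)
    have h3 : 0 ≤ (n : ℝ) * (n : ℝ) ^ s := by positivity
    nlinarith

theorem tsum_logZetaCoeff_mul {s : ℝ} (hs : 0 < s) :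
    ∑' n : ℕ, logZetaCoeff n * exp (-(s * log n)) = log (riemannZeta ((1 + s : ℝ) : ℂ)).re := by
  rw [log_riemannZeta_eq (by linarith)]
  refine tsum_congr fun n => ?_
  rcases Nat.eq_zero_or_pos n with rfl | hn
  · simp [logZetaCoeff]
  · have hn0 : (0 : ℝ) < n := by exact_mod_cast hn
    have : exp (-(s * log n)) = 1 / (n : ℝ) ^ s := by
      rw [rpow_def_of_pos hn0, one_div, ← exp_neg]; ring_nf
    rw [this, rpow_add hn0, rpow_one, logZetaCoeff, div_mul_div_comm, mul_one]
    ring_nf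

theorem hasSum_one_div_mul_exp_neg {s : ℝ} (hs : 0 < s) :
    HasSum (fun n : ℕ => 1 / (n : ℝ) * exp (-(s * n))) (-log (1 - exp (-s))) := by
  have h := hasSum_pow_div_log_of_abs_lt_one (x := exp (-s))
    (by rw [abs_of_pos (exp_pos _)]; simpa using (by linarith : 0 < s))
  rw [← hasSum_nat_add_iff' 1]
  simp only [range_one, sum_singleton, Nat.cast_zero, div_zero, zero_mul, sub_zero]
  have e : (fun n : ℕ => 1 / ((n + 1 : ℕ) : ℝ) * exp (-(s * ((n + 1 : ℕ) : ℝ)))) =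
      fun n : ℕ => exp (-s) ^ (n + 1) / ((n : ℝ) + 1) := by
    ext n
    rw [← exp_nat_mul, div_mul_eq_mul_div, one_mul]
    push_cast
    congr 2
    ring
  rw [e]
  exact h

/-- After the dilation by s, the n-th terms become steps starting at s log n and at s n. Integrating
them against e^(-v) gives n^(-s) and e^(-sn), hence the series for log ζ(1 + s) and -log(1 -
e^(-s)). -/
theorem integral_exp_neg_mul_logZetaSubHarmonic {s : ℝ} (hs : 0 < s) :
    ∫ v in Set.Ioi 0, exp (-v) * logZetaSubHarmonic (v / s) =
      log (riemannZeta ((1 + s : ℝ) : ℂ)).re + log (1 - exp (-s)) := by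
  let F : ℕ → ℝ → ℝ := fun n v => (if s * log n ≤ v then logZetaCoeff n * exp (-v) else 0) -
    (if s * n ≤ v then 1 / (n : ℝ) * exp (-v) else 0)
  have hl1 : ∀ n : ℕ, 0 ≤ s * log n := fun n => mul_nonneg hs.le (log_natCast_nonneg n)
  have hl2 : ∀ n : ℕ, 0 ≤ s * (n : ℝ) := fun n => by positivity
  have hint : ∀ n, Integrable (F n) (volume.restrict (Set.Ioi 0)) := fun n =>
    (integrable_indicator_Ici_exp_neg _ _).sub (integrable_indicator_Ici_exp_neg _ _)
  have hs1 := summable_logZetaCoeff_mul hs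
  have hs2 := hasSum_one_div_mul_exp_neg hs
  have hsum : Summable fun n => ∫ v in Set.Ioi 0, ‖F n v‖ := by
    refine (hs1.add hs2.summable).of_nonneg_of_le (fun n => by positivity) fun n => ?_
    have e1 := integral_norm_indicator_Ici_exp_neg (logZetaCoeff n) (hl1 n)
    have e2 := integral_norm_indicator_Ici_exp_neg (1 / (n : ℝ)) (hl2 n)
    rw [abs_of_nonneg (logZetaCoeff_nonneg n)] at e1
    rw [abs_of_nonneg (by positivity)] at e2
    rw [← e1, ← e2, ← integral_add (integrable_indicator_Ici_exp_neg _ _).norm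
      (integrable_indicator_Ici_exp_neg _ _).norm]
    refine integral_mono (hint n).norm ((integrable_indicator_Ici_exp_neg _ _).norm.add
      (integrable_indicator_Ici_exp_neg _ _).norm) fun v => ?_
    exact norm_sub_le _ _
  have h := hasSum_integral_of_summable_integral_norm hint hsum
  have h2 : ∀ n, ∫ v in Set.Ioi 0, F n v =
      logZetaCoeff n * exp (-(s * log n)) - 1 / (n : ℝ) * exp (-(s * n)) := by
    intro n
    rw [← integral_indicator_Ici_exp_neg _ (hl1 n), ← integral_indicator_Ici_exp_neg _ (hl2 n)]
    exact integral_sub (integrable_indicator_Ici_exp_neg _ _) (integrable_indicator_Ici_exp_neg _ _)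
  simp only [h2] at h
  have h3 := h.unique (hs1.hasSum.sub hs2)
  rw [tsum_logZetaCoeff_mul hs, sub_neg_eq_add] at h3
  rw [← h3]
  refine setIntegral_congr_fun measurableSet_Ioi fun v hv => ?_
  have hv : 0 < v := hv
  have f1 : HasSum (fun n : ℕ => if s * log n ≤ v then logZetaCoeff n * exp (-v) else 0)
      (∑ n ∈ Ioc 0 ⌊exp (v / s)⌋₊, logZetaCoeff n * exp (-v)) := by
    have : ∀ n ∈ Ioc 0 ⌊exp (v / s)⌋₊, logZetaCoeff n * exp (-v) =
        if s * log n ≤ v then logZetaCoeff n * exp (-v) else 0 := by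
      intro n hn
      rw [mem_Ioc] at hn
      rw [if_pos]
      have := (Nat.le_floor_iff (exp_pos _).le).1 hn.2
      rw [← le_div_iff₀' hs]
      exact (log_le_iff_le_exp (by exact_mod_cast hn.1)).2 this
    rw [sum_congr rfl this]
    refine hasSum_sum_of_ne_finset_zero fun n hn => ?_
    rcases Nat.eq_zero_or_pos n with rfl | hn0
    · simp [logZetaCoeff]
    · rw [if_neg]
      intro hle
      apply hn
      rw [mem_Ioc, Nat.le_floor_iff (exp_pos _).le]
      exact ⟨hn0, (log_le_iff_le_exp (by exact_mod_cast hn0)).1 ((le_div_iff₀' hs).2 hle)⟩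
  have f2 : HasSum (fun n : ℕ => if s * (n : ℝ) ≤ v then 1 / (n : ℝ) * exp (-v) else 0)
      (∑ n ∈ Ioc 0 ⌊v / s⌋₊, 1 / (n : ℝ) * exp (-v)) := by
    have : ∀ n ∈ Ioc 0 ⌊v / s⌋₊, 1 / (n : ℝ) * exp (-v) =
        if s * (n : ℝ) ≤ v then 1 / (n : ℝ) * exp (-v) else 0 := by
      intro n hn
      rw [mem_Ioc, Nat.le_floor_iff (by positivity)] at hn
      rw [if_pos]
      exact (le_div_iff₀' hs).1 hn.2
    rw [sum_congr rfl this]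
    refine hasSum_sum_of_ne_finset_zero fun n hn => ?_
    rcases Nat.eq_zero_or_pos n with rfl | hn0
    · simp
    · rw [if_neg]
      intro hle
      apply hn
      rw [mem_Ioc, Nat.le_floor_iff (by positivity)]
      exact ⟨hn0, (le_div_iff₀' hs).2 hle⟩
  have f3 := (f1.sub f2).tsum_eq
  simp only [F]
  rw [f3, logZetaSubHarmonic, ← sum_mul, ← sum_mul]
  ring

theorem tendsto_log_sub_log_floor :
    Tendsto (fun y : ℝ => log y - log (⌊y⌋₊ : ℝ)) atTop (𝓝 0) := by
  have h : Tendsto (fun y : ℝ => (⌊y⌋₊ : ℝ) / y) atTop (𝓝 1) := tendsto_nat_floor_div_atTop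
  have h2 := (h.log one_ne_zero).neg
  rw [log_one, neg_zero] at h2
  refine h2.congr' ?_
  filter_upwards [eventually_ge_atTop 1] with y hy
  have : 0 < ⌊y⌋₊ := Nat.floor_pos.2 hy
  rw [log_div (by positivity) (by positivity)]
  ring

/-- The cutoffs e^t and t are matched so that log log e^t = log t cancels the growth of the harmonic
sum; only the effect of the floors has to be shown negligible. -/
theorem tendsto_logZetaSubHarmonic {M : ℝ} (hM : Tendsto logZetaPartialError atTop (𝓝 M)) :
    Tendsto logZetaSubHarmonic atTop (𝓝 (M - eulerMascheroniConstant)) := by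
  have h1 : Tendsto (fun t : ℝ => logZetaPartialError ⌊exp t⌋₊) atTop (𝓝 M) :=
    hM.comp (tendsto_nat_floor_atTop.comp tendsto_exp_atTop)
  have h2 : Tendsto (fun t : ℝ => (harmonic ⌊t⌋₊ : ℝ) - log (⌊t⌋₊ : ℝ)) atTop
      (𝓝 eulerMascheroniConstant) :=
    tendsto_harmonic_sub_log.comp tendsto_nat_floor_atTop
  have h3 : Tendsto (fun t : ℝ => log (log (⌊exp t⌋₊ : ℝ) / t)) atTop (𝓝 0) := by
    have a := tendsto_log_sub_log_floor.comp tendsto_exp_atTop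
    have b : Tendsto (fun t : ℝ => 1 - (log (exp t) - log (⌊exp t⌋₊ : ℝ)) * t⁻¹) atTop (𝓝 1) := by
      simpa using (a.mul tendsto_inv_atTop_zero).const_sub 1
    have c := b.log one_ne_zero
    rw [log_one] at c
    refine c.congr' ?_
    filter_upwards [eventually_gt_atTop 0] with t ht
    rw [log_exp]
    congr 1
    field_simp
    ring
  have h := ((h1.add h3).sub h2).add tendsto_log_sub_log_floor
  rw [add_zero, add_zero] at h
  refine h.congr' ?_
  filter_upwards [eventually_ge_atTop 2] with t ht
  have h4 : 1 < log (⌊exp t⌋₊ : ℝ) := by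
    have e0 : exp 1 * 2 ≤ exp t := by
      have : exp 2 ≤ exp t := exp_le_exp.2 ht
      have e : exp (2 : ℝ) = exp 1 * exp 1 := by rw [← exp_add]; norm_num
      have := exp_one_gt_d9
      nlinarith
    have e1 := Nat.lt_floor_add_one (exp t)
    have := exp_one_gt_d9
    rw [lt_log_iff_exp_lt]
    · linarith
    · linarith
  have h5 : log (log (⌊exp t⌋₊ : ℝ) / t) = log (log (⌊exp t⌋₊ : ℝ)) - log t :=
    log_div (by linarith) (by linarith)
  have h6 : (harmonic ⌊t⌋₊ : ℝ) = ∑ n ∈ Ioc 0 ⌊t⌋₊, 1 / (n : ℝ) := by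
    rw [harmonic_eq_sum_Icc]
    push_cast
    refine sum_congr ?_ fun n _ => by rw [one_div]
    ext; simp [Nat.succ_le_iff]
  rw [h5, h6, logZetaSubHarmonic, logZetaPartialError]
  ring

/-- Supplies the dominating function for the limit under the integral. Past some T the limit
controls the values; before T both sums are monotone. -/
theorem exists_abs_logZetaSubHarmonic_le {c : ℝ} (h : Tendsto logZetaSubHarmonic atTop (𝓝 c)) :
    ∃ B : ℝ, ∀ t, |logZetaSubHarmonic t| ≤ B := by
  have h1 := h.abs.eventually_le_const (lt_add_one |c|)
  obtain ⟨T, hT⟩ := eventually_atTop.1 h1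
  refine ⟨(|c| + 1) + (∑ n ∈ Ioc 0 ⌊exp T⌋₊, logZetaCoeff n + ∑ n ∈ Ioc 0 ⌊T⌋₊, 1 / (n : ℝ)),
    fun t => ?_⟩
  have p1 : 0 ≤ ∑ n ∈ Ioc 0 ⌊exp T⌋₊, logZetaCoeff n := sum_nonneg fun n _ => logZetaCoeff_nonneg n
  have p2 : 0 ≤ ∑ n ∈ Ioc 0 ⌊T⌋₊, 1 / (n : ℝ) := sum_nonneg fun n _ => by positivity
  rcases le_total T t with ht | ht
  · have := hT t ht
    linarith
  · have q1 : ∑ n ∈ Ioc 0 ⌊exp t⌋₊, logZetaCoeff n ≤ ∑ n ∈ Ioc 0 ⌊exp T⌋₊, logZetaCoeff n :=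
      sum_le_sum_of_subset_of_nonneg (Ioc_subset_Ioc_right (Nat.floor_mono (exp_le_exp.2 ht)))
        fun n _ _ => logZetaCoeff_nonneg n
    have q2 : ∑ n ∈ Ioc 0 ⌊t⌋₊, 1 / (n : ℝ) ≤ ∑ n ∈ Ioc 0 ⌊T⌋₊, 1 / (n : ℝ) :=
      sum_le_sum_of_subset_of_nonneg (Ioc_subset_Ioc_right (Nat.floor_mono ht))
        fun n _ _ => by positivity
    have p3 : 0 ≤ ∑ n ∈ Ioc 0 ⌊exp t⌋₊, logZetaCoeff n :=
      sum_nonneg fun n _ => logZetaCoeff_nonneg n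
    have p4 : 0 ≤ ∑ n ∈ Ioc 0 ⌊t⌋₊, 1 / (n : ℝ) := sum_nonneg fun n _ => by positivity
    have := abs_nonneg c
    rw [logZetaSubHarmonic, abs_le]
    constructor <;> linarith

theorem measurable_logZetaSubHarmonic : Measurable logZetaSubHarmonic := by
  have h1 : Measurable (fun m : ℕ => ∑ n ∈ Ioc 0 m, logZetaCoeff n) := measurable_of_countable _
  have h2 : Measurable (fun m : ℕ => ∑ n ∈ Ioc 0 m, 1 / (n : ℝ)) := measurable_of_countable _
  exact (h1.comp (Nat.measurable_floor.comp measurable_exp)).sub (h2.comp Nat.measurable_floor)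

/-- The residue of ζ at 1 is 1 and 1 - e^(-s) ~ s, so the two logarithms cancel in the limit. -/
theorem tendsto_log_zeta_add_log :
    Tendsto (fun s : ℝ => log (riemannZeta ((1 + s : ℝ) : ℂ)).re + log (1 - exp (-s)))
      (𝓝[>] 0) (𝓝 0) := by
  have h1 : Tendsto (fun s : ℝ => s * (riemannZeta ((1 + s : ℝ) : ℂ)).re) (𝓝[>] 0) (𝓝 1) := by
    have hc : Tendsto (fun s : ℝ => ((1 + s : ℝ) : ℂ)) (𝓝[>] 0) (𝓝[≠] 1) := by
      refine tendsto_nhdsWithin_iff.2 ⟨?_, ?_⟩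
      · have : Continuous (fun s : ℝ => ((1 + s : ℝ) : ℂ)) := by fun_prop
        have := (this.tendsto 0).mono_left (nhdsWithin_le_nhds (s := Set.Ioi 0))
        simpa using this
      · filter_upwards [self_mem_nhdsWithin] with s hs
        have hs : 0 < s := hs
        simpa using hs.ne'
    have h := (Complex.continuous_re.tendsto _).comp (riemannZeta_residue_one.comp hc)
    rw [Complex.one_re] at h
    refine h.congr fun s => ?_
    simp [Complex.mul_re]
  have h2 : Tendsto (fun s : ℝ => (1 - exp (-s)) / s) (𝓝[>] 0) (𝓝 1) := by
    have hd : HasDerivAt (fun s : ℝ => 1 - exp (-s)) 1 0 := by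
      have := ((hasDerivAt_neg (0 : ℝ)).exp).const_sub 1
      simpa using this
    have := (hasDerivAt_iff_tendsto_slope.1 hd).mono_left
      (nhdsWithin_mono 0 (fun s (hs : 0 < s) => hs.ne') : 𝓝[>] (0 : ℝ) ≤ 𝓝[≠] 0)
    refine this.congr fun s => ?_
    simp [slope_def_field]
  have h := (h1.log one_ne_zero).add (h2.log one_ne_zero)
  rw [log_one, add_zero] at h
  refine h.congr' ?_
  filter_upwards [self_mem_nhdsWithin, h1.eventually_const_lt zero_lt_one] with s hs hz
  have hs : 0 < s := hs
  have hz' : 0 < (riemannZeta ((1 + s : ℝ) : ℂ)).re := pos_of_mul_pos_right hz hs.le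
  have he : 0 < 1 - exp (-s) := by
    have : exp (-s) < 1 := by simpa using (by linarith : 0 < s)
    linarith
  rw [log_mul hs.ne' hz'.ne', log_div he.ne' hs.ne']
  ring

/-- As s → 0+, the dilated integral tends to M - γ by dominated convergence, and to 0 by its closed
form. -/
theorem logZetaPartialError_limit_eq {M : ℝ} (hM : Tendsto logZetaPartialError atTop (𝓝 M)) :
    M = eulerMascheroniConstant := by
  have hE := tendsto_logZetaSubHarmonic hM
  obtain ⟨B, hB⟩ := exists_abs_logZetaSubHarmonic_le hE
  have h1 : Tendsto (fun s : ℝ => ∫ v in Set.Ioi 0, exp (-v) * logZetaSubHarmonic (v / s))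
      (𝓝[>] 0) (𝓝 (∫ v in Set.Ioi 0, exp (-v) * (M - eulerMascheroniConstant))) := by
    refine tendsto_integral_filter_of_dominated_convergence (fun v => exp (-v) * B) ?_ ?_ ?_ ?_
    · refine Eventually.of_forall fun s => Measurable.aestronglyMeasurable ?_
      exact (measurable_exp.comp measurable_neg).mul
        (measurable_logZetaSubHarmonic.comp (measurable_id.div_const s))
    · refine Eventually.of_forall fun s => Eventually.of_forall fun v => ?_
      rw [norm_mul, norm_of_nonneg (exp_pos _).le]
      exact mul_le_mul_of_nonneg_left (hB _) (exp_pos _).le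
    · exact (integrableOn_exp_neg_Ioi 0).mul_const B
    · filter_upwards [ae_restrict_mem measurableSet_Ioi] with v hv
      refine Tendsto.const_mul _ (hE.comp ?_)
      have hv : (0 : ℝ) < v := hv
      change Tendsto (fun s : ℝ => v * s⁻¹) (𝓝[>] 0) atTop
      exact tendsto_inv_nhdsGT_zero.const_mul_atTop hv
  rw [integral_mul_const, integral_exp_neg_Ioi_zero, one_mul] at h1
  have h2 : Tendsto (fun s : ℝ => ∫ v in Set.Ioi 0, exp (-v) * logZetaSubHarmonic (v / s))
      (𝓝[>] 0) (𝓝 0) := by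
    refine tendsto_log_zeta_add_log.congr' ?_
    filter_upwards [self_mem_nhdsWithin] with s hs
    exact (integral_exp_neg_mul_logZetaSubHarmonic hs).symm
  linarith [tendsto_nhds_unique h1 h2]

theorem exists_abs_sum_logZetaCoeff_sub_le :
    ∃ K : ℝ, 0 ≤ K ∧ ∀ n : ℕ, 2 ≤ n →
      |∑ m ∈ Ioc 0 n, logZetaCoeff m - (log (log n) + eulerMascheroniConstant)| ≤ K / log n := by
  obtain ⟨M, K, hK, h⟩ := exists_abs_logZetaPartialError_sub_le
  have hlog : Tendsto (fun n : ℕ => log (n : ℝ)) atTop atTop :=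
    tendsto_log_atTop.comp tendsto_natCast_atTop_atTop
  have hM : Tendsto logZetaPartialError atTop (𝓝 M) := by
    rw [tendsto_iff_norm_sub_tendsto_zero]
    refine squeeze_zero' (Eventually.of_forall fun n => norm_nonneg _) ?_ (hlog.const_div_atTop K)
    filter_upwards [eventually_ge_atTop 2] with n hn using h n hn
  rw [logZetaPartialError_limit_eq hM] at h
  refine ⟨K, hK, fun n hn => ?_⟩
  have := h n hn
  rw [logZetaPartialError] at this
  rwa [← sub_sub]

end MertensConstant

/-! ### From prime powers to primes: Mertens' second theorem. -/

section MertensSecond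

open Real Finset Filter Topology
open ArithmeticFunction (vonMangoldt)
open scoped ArithmeticFunction.vonMangoldt

/-- Sums over the proper prime powers `p ^ (i + 2)` weighted by a power of the exponent converge
for exponents beyond `1 / 2`. -/
theorem summable_pow_mul_properPrimePow_rpow (l : ℕ) {σ : ℝ} (hσ : 1 / 2 < σ) :
    Summable (fun x : Nat.Primes × ℕ =>
      ((x.2 : ℝ) + 2) ^ l * (((x.1 : ℕ) : ℝ) ^ (x.2 + 2)) ^ (-σ)) := by
  have h1 : Summable (fun p : Nat.Primes => ((p : ℕ) : ℝ) ^ (-(2 * σ))) :=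
    (Nat.Primes.summable_rpow).2 (by linarith)
  have h2 : Summable (fun i : ℕ => ((i : ℝ) + 2) ^ l * ((2 : ℝ) ^ (-σ)) ^ i) := by
    have hr : (2 : ℝ) ^ (-σ) < 1 := rpow_lt_one_of_one_lt_of_neg (by norm_num) (by linarith)
    have hr0 : 0 < (2 : ℝ) ^ (-σ) := by positivity
    have := summable_pow_mul_geometric_of_norm_lt_one l (r := (2 : ℝ) ^ (-σ))
      (by rwa [norm_of_nonneg hr0.le])
    have h3 := ((summable_nat_add_iff 2).2 this).mul_right (((2 : ℝ) ^ (-σ)) ^ 2)⁻¹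
    refine h3.congr fun i => ?_
    push_cast
    rw [pow_add]
    field_simp
  refine (h1.mul_of_nonneg h2 (fun p => by positivity) (fun i => by positivity)).of_nonneg_of_le
    (fun x => by positivity) fun x => ?_
  obtain ⟨p, i⟩ := x
  have hp : (0 : ℝ) < (p : ℕ) := by exact_mod_cast p.2.pos
  have hp2 : (2 : ℝ) ≤ (p : ℕ) := by exact_mod_cast p.2.two_le
  dsimp only
  have e : (((p : ℕ) : ℝ) ^ (i + 2)) ^ (-σ) =
      ((p : ℕ) : ℝ) ^ (-(2 * σ)) * (((p : ℕ) : ℝ) ^ (-σ)) ^ i := by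
    rw [← rpow_natCast, ← rpow_mul hp.le, ← rpow_natCast, ← rpow_mul hp.le, ← rpow_add hp]
    congr 1; push_cast; ring
  rw [e]
  have : ((p : ℕ) : ℝ) ^ (-σ) ≤ (2 : ℝ) ^ (-σ) :=
    rpow_le_rpow_of_nonpos (by norm_num) hp2 (by linarith)
  have h3 : (((p : ℕ) : ℝ) ^ (-σ)) ^ i ≤ ((2 : ℝ) ^ (-σ)) ^ i := by gcongr
  calc _ = ((p : ℕ) : ℝ) ^ (-(2 * σ)) * (((i : ℝ) + 2) ^ l * (((p : ℕ) : ℝ) ^ (-σ)) ^ i) := by ring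
    _ ≤ _ := by gcongr

/-- The coefficient `Λ(n) / (n log n)` for `n` not a prime, and zero for a prime. -/
noncomputable def logZetaCoeffNonprime (n : ℕ) : ℝ := if n.Prime then 0 else logZetaCoeff n

theorem logZetaCoeffNonprime_nonneg (n : ℕ) : 0 ≤ logZetaCoeffNonprime n := by
  rw [logZetaCoeffNonprime]; split_ifs
  exacts [le_rfl, logZetaCoeff_nonneg n]

theorem injective_properPrimePow :
    Function.Injective (fun x : Nat.Primes × ℕ => (x.1 : ℕ) ^ (x.2 + 2)) := by
  rintro ⟨p, i⟩ ⟨q, j⟩ h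
  have h : (p : ℕ) ^ (i + 2) = (q : ℕ) ^ (j + 2) := h
  have hpq : (p : ℕ) = q := by
    have : (p : ℕ) ∣ (q : ℕ) ^ (j + 2) := h ▸ dvd_pow_self _ (by omega)
    exact (Nat.prime_dvd_prime_iff_eq p.2 q.2).1 (p.2.dvd_of_dvd_pow this)
  have hij := Nat.pow_right_injective p.2.two_le (h.trans (by rw [hpq]))
  simp only [Prod.mk.injEq]
  exact ⟨Subtype.ext hpq, by omega⟩

theorem logZetaCoeffNonprime_eq_zero {n : ℕ}
    (hn : n ∉ Set.range (fun x : Nat.Primes × ℕ => (x.1 : ℕ) ^ (x.2 + 2))) :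
    logZetaCoeffNonprime n = 0 := by
  rw [logZetaCoeffNonprime]
  split_ifs with hp
  · rfl
  · by_cases h : IsPrimePow n
    · obtain ⟨p, k, hp', hk, rfl⟩ := (isPrimePow_nat_iff n).1 h
      exfalso
      obtain rfl | hk2 : k = 1 ∨ 2 ≤ k := by omega
      · simp [hp'] at hp
      · exact hn ⟨(⟨p, hp'⟩, k - 2), by simp [Nat.sub_add_cancel hk2]⟩
    · rw [logZetaCoeff, ArithmeticFunction.vonMangoldt_eq_zero_iff.2 h, zero_div]

theorem logZetaCoeffNonprime_properPrimePow (p : Nat.Primes) (i : ℕ) :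
    logZetaCoeffNonprime ((p : ℕ) ^ (i + 2)) = (1 / ((p : ℕ) : ℝ)) ^ (i + 2) / ((i : ℝ) + 2) := by
  rw [logZetaCoeffNonprime, if_neg (Nat.Prime.not_prime_pow (by omega)), logZetaCoeff,
    ArithmeticFunction.vonMangoldt_apply_pow (by omega),
    ArithmeticFunction.vonMangoldt_apply_prime p.2]
  have hp2 : (2 : ℝ) ≤ (p : ℕ) := by exact_mod_cast p.2.two_le
  have hl : 0 < log ((p : ℕ) : ℝ) := log_pos (by linarith)
  push_cast
  rw [log_pow, one_div, inv_pow]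
  push_cast
  field_simp

theorem hasSum_properPrimePow_log (p : Nat.Primes) :
    HasSum (fun i : ℕ => (1 / ((p : ℕ) : ℝ)) ^ (i + 2) / ((i : ℝ) + 2))
      (-(log (1 - 1 / ((p : ℕ) : ℝ)) + 1 / ((p : ℕ) : ℝ))) := by
  have hp2 : (2 : ℝ) ≤ (p : ℕ) := by exact_mod_cast p.2.two_le
  have h := hasSum_pow_div_log_of_abs_lt_one (x := 1 / ((p : ℕ) : ℝ))
    (by rw [abs_of_pos (by positivity), div_lt_one (by linarith)]; linarith)
  rw [← hasSum_nat_add_iff' 1] at h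
  simp only [range_one, sum_singleton, Nat.cast_zero, zero_add, pow_one, div_one] at h
  have e : (fun i : ℕ => (1 / ((p : ℕ) : ℝ)) ^ (i + 2) / ((i : ℝ) + 2)) =
      fun i : ℕ => (1 / ((p : ℕ) : ℝ)) ^ (i + 1 + 1) / (((i + 1 : ℕ) : ℝ) + 1) := by
    ext i; push_cast; ring_nf
  rw [e, neg_add, ← sub_eq_add_neg]
  exact h

/-- The room n^δ is what later yields a rate for the tail; it is available because only proper prime
powers contribute. -/
theorem summable_logZetaCoeffNonprime_mul_rpow {δ : ℝ} (hδ : δ < 1 / 2) :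
    Summable (fun n : ℕ => logZetaCoeffNonprime n * (n : ℝ) ^ δ) := by
  rw [← injective_properPrimePow.summable_iff
    (fun n hn => by rw [logZetaCoeffNonprime_eq_zero hn, zero_mul])]
  refine (summable_pow_mul_properPrimePow_rpow 0 (σ := 1 - δ) (by linarith)).of_nonneg_of_le
    (fun x => mul_nonneg (logZetaCoeffNonprime_nonneg _) (by positivity)) ?_
  rintro ⟨p, i⟩
  simp only [Function.comp]
  rw [logZetaCoeffNonprime_properPrimePow, pow_zero, one_mul]
  have hp : (0 : ℝ) < (p : ℕ) := by exact_mod_cast p.2.pos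
  push_cast
  have hq : (0 : ℝ) < ((p : ℕ) : ℝ) ^ (i + 2) := by positivity
  rw [neg_sub, rpow_sub hq, rpow_one, one_div, inv_pow]
  set q := ((p : ℕ) : ℝ) ^ (i + 2)
  have : q⁻¹ / ((i : ℝ) + 2) ≤ q⁻¹ :=
    div_le_self (by positivity) (by have : (0 : ℝ) ≤ i := by positivity
                                    linarith)
  calc q⁻¹ / ((i : ℝ) + 2) * q ^ δ ≤ q⁻¹ * q ^ δ := by gcongr
    _ = q ^ δ / q := by ring

theorem summable_logZetaCoeffNonprime : Summable logZetaCoeffNonprime := by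
  simpa using summable_logZetaCoeffNonprime_mul_rpow (δ := 0) (by norm_num)

/-- Sum over the exponents first: for each p this is the Taylor series of -log(1 - 1/p) without its
linear term. -/
theorem hasSum_log_one_sub_add_one_div :
    HasSum (fun p : Nat.Primes => log (1 - 1 / ((p : ℕ) : ℝ)) + 1 / ((p : ℕ) : ℝ))
      (-∑' n, logZetaCoeffNonprime n) := by
  have h := summable_logZetaCoeffNonprime.hasSum
  rw [← injective_properPrimePow.hasSum_iff fun n hn => logZetaCoeffNonprime_eq_zero hn] at h
  have := (h.prod_fiberwise (g := fun p : Nat.Primes =>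
    -(log (1 - 1 / ((p : ℕ) : ℝ)) + 1 / ((p : ℕ) : ℝ))) fun p => ?_).neg
  · simpa only [neg_neg] using this
  · simp only [Function.comp, logZetaCoeffNonprime_properPrimePow]
    exact hasSum_properPrimePow_log p

/-- Rankin's trick: 1 ≤ (n/N)^δ for every n in the tail. -/
theorem abs_tsum_sub_sum_Ioc_le {b : ℕ → ℝ} (hb : ∀ n, 0 ≤ b n) (hb0 : b 0 = 0) {δ : ℝ}
    (hδ : 0 ≤ δ) (h : Summable b) (hs : Summable (fun n : ℕ => b n * (n : ℝ) ^ δ)) {N : ℕ}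
    (hN : 0 < N) :
    |∑ n ∈ Ioc 0 N, b n - ∑' n, b n| ≤ (∑' n : ℕ, b n * (n : ℝ) ^ δ) / (N : ℝ) ^ δ := by
  have h1 : HasSum (fun n => if n ∈ Ioc 0 N then b n else 0) (∑ n ∈ Ioc 0 N, b n) := by
    rw [sum_congr rfl (fun n hn => (if_pos hn).symm :
      ∀ n ∈ Ioc 0 N, b n = if n ∈ Ioc 0 N then b n else 0)]
    exact hasSum_sum_of_ne_finset_zero fun n hn => if_neg hn
  have h2 := h.hasSum.sub h1
  have hN' : (0 : ℝ) < N := by exact_mod_cast hN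
  have h3 : ∀ n, 0 ≤ b n - (if n ∈ Ioc 0 N then b n else 0) := fun n => by
    split_ifs
    · simp
    · simpa using hb n
  rw [abs_sub_comm, abs_of_nonneg (h2.nonneg h3)]
  refine hasSum_le (fun n => ?_) h2 (hs.hasSum.div_const _)
  split_ifs with hn
  · rw [sub_self]; exact div_nonneg (mul_nonneg (hb n) (by positivity)) (by positivity)
  · rcases Nat.eq_zero_or_pos n with rfl | hn0
    · simp [hb0]
    · have : N < n := by simp only [mem_Ioc, not_and, not_le] at hn; exact hn hn0
      rw [sub_zero, le_div_iff₀ (by positivity)]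
      gcongr
      exact hb n

theorem exists_abs_sum_prime_one_div_sub_le :
    ∃ K : ℝ, 0 ≤ K ∧ ∀ n : ℕ, 2 ≤ n →
      |∑ p ∈ (Ioc 0 n).filter Nat.Prime, 1 / (p : ℝ) - (log (log n) + (eulerMascheroniConstant +
        ∑' p : Nat.Primes, (log (1 - 1 / ((p : ℕ) : ℝ)) + 1 / ((p : ℕ) : ℝ))))| ≤ K / log n := by
  obtain ⟨K, hK, h⟩ := exists_abs_sum_logZetaCoeff_sub_le
  set A := ∑' n : ℕ, logZetaCoeffNonprime n * (n : ℝ) ^ (1 / 4 : ℝ)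
  have hA : 0 ≤ A := tsum_nonneg fun n => mul_nonneg (logZetaCoeffNonprime_nonneg n) (by positivity)
  -- The 4 is 1/δ with δ = 1/4, from log n ≤ n^δ / δ.
  refine ⟨K + A * 4, by positivity, fun n hn => ?_⟩
  have hn2 : (2 : ℝ) ≤ n := by exact_mod_cast hn
  have hl : 0 < log (n : ℝ) := log_pos (by linarith)
  have h1 := h n hn
  have h2 := abs_tsum_sub_sum_Ioc_le logZetaCoeffNonprime_nonneg
    (by simp [logZetaCoeffNonprime, logZetaCoeff, Nat.not_prime_zero])
    (by norm_num) summable_logZetaCoeffNonprime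
    (summable_logZetaCoeffNonprime_mul_rpow (δ := 1 / 4) (by norm_num)) (N := n) (by omega)
  have h3 : A / (n : ℝ) ^ (1 / 4 : ℝ) ≤ A * 4 / log n := by
    have := log_le_rpow_div (x := (n : ℝ)) (by linarith) (show (0 : ℝ) < 1 / 4 by norm_num)
    have hp : 0 < (n : ℝ) ^ (1 / 4 : ℝ) := by positivity
    rw [div_le_div_iff₀ hp hl, mul_assoc]
    apply mul_le_mul_of_nonneg_left _ hA
    linarith
  rw [hasSum_log_one_sub_add_one_div.tsum_eq]
  have e : ∑ m ∈ Ioc 0 n, logZetaCoeff m = ∑ p ∈ (Ioc 0 n).filter Nat.Prime, 1 / (p : ℝ) +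
      ∑ m ∈ Ioc 0 n, logZetaCoeffNonprime m := by
    rw [sum_filter, ← sum_add_distrib]
    refine sum_congr rfl fun m _ => ?_
    rw [logZetaCoeffNonprime]
    split_ifs with hp
    · have hm2 : (2 : ℝ) ≤ m := by exact_mod_cast hp.two_le
      have hl : 0 < log (m : ℝ) := log_pos (by linarith)
      rw [logZetaCoeff, ArithmeticFunction.vonMangoldt_apply_prime hp]
      field_simp
      simp
    · simp
  rw [e] at h1
  rw [abs_le] at h1 h2 ⊢
  have e3 : (K + A * 4) / log (n : ℝ) = K / log n + A * 4 / log n := by ring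
  constructor <;> linarith

/-- Transfers the integer estimate to real x: ⌊x⌋ ≥ x/2, and x ≥ 4 makes log 2 at most half of log
x. -/
theorem abs_log_log_floor_sub_le {x : ℝ} (hx : 4 ≤ x) :
    |log (log (⌊x⌋₊ : ℝ)) - log (log x)| ≤ 2 / log x ∧ log x / 2 ≤ log (⌊x⌋₊ : ℝ) := by
  have h0 := Nat.lt_floor_add_one x
  have h1 := Nat.floor_le (by linarith : 0 ≤ x)
  have h2 : x ≤ 2 * ⌊x⌋₊ := by linarith
  have hf : (0 : ℝ) < ⌊x⌋₊ := by linarith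
  have h3 : log x ≤ log 2 + log (⌊x⌋₊ : ℝ) := by
    rw [← log_mul (by norm_num) hf.ne']
    exact log_le_log (by linarith) h2
  have h4 : 2 * log 2 ≤ log x := by
    have : (2 : ℝ) * log 2 = log (2 ^ 2) := by rw [log_pow]; norm_num
    rw [this]
    exact log_le_log (by norm_num) (by linarith)
  have hl2 : 0 < log (2 : ℝ) := log_pos (by norm_num)
  have h5 : log x / 2 ≤ log (⌊x⌋₊ : ℝ) := by linarith
  have h6 : log (⌊x⌋₊ : ℝ) ≤ log x := log_le_log hf h1
  refine ⟨?_, h5⟩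
  have hlx : 0 < log x := by linarith
  have hlf : 0 < log (⌊x⌋₊ : ℝ) := by linarith
  have h7 : log (log (⌊x⌋₊ : ℝ)) ≤ log (log x) := log_le_log hlf h6
  rw [abs_sub_comm, abs_of_nonneg (by linarith), ← log_div hlx.ne' hlf.ne']
  have h8 := log_le_sub_one_of_pos (x := log x / log (⌊x⌋₊ : ℝ)) (by positivity)
  refine h8.trans ?_
  have h9 : log x / log (⌊x⌋₊ : ℝ) - 1 = (log x - log (⌊x⌋₊ : ℝ)) / log (⌊x⌋₊ : ℝ) := by
    field_simp
  rw [h9, div_le_div_iff₀ hlf hlx]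
  have : log (2 : ℝ) ≤ 1 := by have := log_two_lt_d9; linarith
  nlinarith

/-- Mertens' second theorem, with the value of the constant. -/
theorem mertens_second :
    (fun x : ℝ => ∑ p ∈ (Ioc 0 ⌊x⌋₊).filter Nat.Prime, 1 / (p : ℝ) -
      (log (log x) + (eulerMascheroniConstant +
        ∑' p : Nat.Primes, (log (1 - 1 / ((p : ℕ) : ℝ)) + 1 / ((p : ℕ) : ℝ))))) =O[atTop]
      fun x : ℝ => 1 / log x := by
  obtain ⟨K, hK, h⟩ := exists_abs_sum_prime_one_div_sub_le
  refine Asymptotics.IsBigO.of_bound (2 * K + 2) ?_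
  filter_upwards [eventually_ge_atTop 4] with x hx
  obtain ⟨h1, h2⟩ := abs_log_log_floor_sub_le hx
  have hf : 2 ≤ ⌊x⌋₊ := Nat.le_floor (by push_cast; linarith)
  have h3 := h _ hf
  have hlx : 0 < log x := log_pos (by linarith)
  have h4 : K / log (⌊x⌋₊ : ℝ) ≤ 2 * K / log x := by
    rw [div_le_div_iff₀ (by linarith) hlx]
    nlinarith
  rw [norm_eq_abs, norm_of_nonneg (by positivity)]
  have e : (2 * K + 2) * (1 / log x) = 2 * K / log x + 2 / log x := by ring
  rw [e]
  rw [abs_le] at h1 h3 ⊢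
  constructor <;> linarith

end MertensSecond

/-! ### Exact expansion over prime powers, and the constants. -/

section GcdSum

open Finset Filter Topology

namespace IsAdditiveArith

variable {f : ℕ → ℂ}

theorem map_one (hf : IsAdditiveArith f) : f 1 = 0 := by
  have := hf 1 1 le_rfl le_rfl (Nat.coprime_one_left 1)
  simpa using this

theorem eq_sum_primeFactors (hf : IsAdditiveArith f) {n : ℕ} (hn : n ≠ 0) :
    f n = ∑ p ∈ n.primeFactors, f (p ^ n.factorization p) := by
  induction n using Nat.recOnPosPrimePosCoprime with
  | zero => exact absurd rfl hn
  | one => simp [hf.map_one]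
  | prime_pow p k hp hk => simp [Nat.primeFactors_prime_pow hk.ne' hp, hp.factorization_self]
  | coprime a b ha hb hab iha ihb =>
    rw [hf a b ha.le hb.le hab, iha (by omega), ihb (by omega), hab.primeFactors_mul,
      sum_union hab.disjoint_primeFactors]
    congr 1
    · refine sum_congr rfl fun p hp => ?_
      rw [Nat.factorization_eq_of_coprime_left hab (by simpa using hp)]
    · refine sum_congr rfl fun p hp => ?_
      rw [Nat.factorization_eq_of_coprime_right hab (by simpa using hp)]

end IsAdditiveArith

/-- The increment `f (p ^ (i + 1)) - f (p ^ i)`, the weight of the condition `p ^ (i + 1) ∣ n`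
in the value `f n` of an additive function. -/
noncomputable def primePowIncrement (f : ℕ → ℂ) (p i : ℕ) : ℂ := f (p ^ (i + 1)) - f (p ^ i)

theorem IsAdditiveArith.eq_sum_primePowIncrement {f : ℕ → ℂ} (hf : IsAdditiveArith f) {n N : ℕ}
    (hn : n ≠ 0) (hN : n ≤ N) :
    f n = ∑ p ∈ (Ioc 0 N).filter Nat.Prime, ∑ i ∈ range (N + 1),
      if p ^ (i + 1) ∣ n then primePowIncrement f p i else 0 := by
  rw [hf.eq_sum_primeFactors hn]
  have hsub : n.primeFactors ⊆ (Ioc 0 N).filter Nat.Prime := fun p hp => by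
    have hp' := Nat.prime_of_mem_primeFactors hp
    simp only [mem_filter, mem_Ioc]
    exact ⟨⟨hp'.pos, (Nat.le_of_mem_primeFactors hp).trans hN⟩, hp'⟩
  -- The ranges depend on N only, so that they can be exchanged with the sum over tuples; the
  -- surplus terms fail the divisibility test.
  rw [← sum_subset hsub fun p hp hpn => ?_]
  · refine sum_congr rfl fun p hp => ?_
    have hp' := Nat.prime_of_mem_primeFactors hp
    have h1 : f (p ^ n.factorization p) =
        ∑ i ∈ range (n.factorization p), primePowIncrement f p i := by
      simp only [primePowIncrement]
      rw [sum_range_sub (fun i => f (p ^ i)), pow_zero, hf.map_one, sub_zero]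
    rw [h1, ← sum_filter]
    refine sum_congr ?_ fun _ _ => rfl
    ext i
    have := Nat.factorization_lt p hn
    rw [mem_filter, hp'.pow_dvd_iff_le_factorization hn, mem_range, mem_range]
    omega
  · refine sum_eq_zero fun i _ => if_neg fun h => hpn ?_
    rw [Nat.mem_primeFactors]
    exact ⟨(mem_filter.1 hp).2, (dvd_pow_self p (by omega)).trans h, hn⟩

/-- The indicator of q dividing the gcd is a product over the coordinates, so the sum over tuples is
a k-th power of the number of multiples of q. -/
theorem sum_piFinset_dvd_gcd (k N q : ℕ) (c : ℂ) :
    ∑ n ∈ Fintype.piFinset (fun _ : Fin k => Icc 1 N), (if q ∣ univ.gcd n then c else 0) =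
      c * ((N / q : ℕ) : ℂ) ^ k := by
  have h1 : ∀ n : Fin k → ℕ, (if q ∣ univ.gcd n then c else 0) =
      c * ∏ i, (if q ∣ n i then (1 : ℂ) else 0) := by
    intro n
    rw [prod_ite_zero]
    simp [Finset.dvd_gcd_iff]
  simp only [h1]
  have h2 := prod_univ_sum (fun _ : Fin k => Icc 1 N) (fun _ m => if q ∣ m then (1 : ℂ) else 0)
  rw [← mul_sum, ← h2, prod_const, card_univ, Fintype.card_fin]
  congr 2
  rw [sum_boole, ← Nat.card_multiples' N q]
  congr 2
  ext m
  simp only [mem_filter, mem_Icc, mem_range]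
  constructor <;> intro h <;> refine ⟨?_, ?_⟩ <;> omega

theorem gcdSum_eq_sum_sum {f : ℕ → ℂ} (hf : IsAdditiveArith f) {k : ℕ} (hk : k ≠ 0) (x : ℝ) :
    gcdSum f k x = ∑ p ∈ (Ioc 0 ⌊x⌋₊).filter Nat.Prime, ∑ i ∈ range (⌊x⌋₊ + 1),
      primePowIncrement f p i * ((⌊x⌋₊ / p ^ (i + 1) : ℕ) : ℂ) ^ k := by
  rw [gcdSum]
  have h : ∀ n ∈ Fintype.piFinset (fun _ : Fin k => Icc 1 ⌊x⌋₊), f (univ.gcd n) =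
      ∑ p ∈ (Ioc 0 ⌊x⌋₊).filter Nat.Prime, ∑ i ∈ range (⌊x⌋₊ + 1),
        if p ^ (i + 1) ∣ univ.gcd n then primePowIncrement f p i else 0 := by
    intro n hn
    rw [Fintype.mem_piFinset] at hn
    have h0 := mem_Icc.1 (hn ⟨0, by omega⟩)
    have hd : univ.gcd n ∣ n ⟨0, by omega⟩ := gcd_dvd (mem_univ _)
    refine hf.eq_sum_primePowIncrement (fun hz => ?_) ((Nat.le_of_dvd (by omega) hd).trans h0.2)
    rw [hz, zero_dvd_iff] at hd
    omega
  rw [sum_congr rfl h, sum_comm]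
  refine sum_congr rfl fun p _ => ?_
  rw [sum_comm]
  exact sum_congr rfl fun i _ => sum_piFinset_dvd_gcd k _ _ _

/-- The primes up to `N`, as a finite set in the type of primes. -/
def primesUpTo (N : ℕ) : Finset Nat.Primes := (Ioc 0 N).subtype Nat.Prime

theorem mem_primesUpTo {N : ℕ} {p : Nat.Primes} : p ∈ primesUpTo N ↔ (p : ℕ) ≤ N := by
  have : p ∈ primesUpTo N ↔ (p : ℕ) ∈ Ioc 0 N := mem_subtype
  rw [this, mem_Ioc]
  exact and_iff_right p.2.pos

theorem sum_primesUpTo {M : Type*} [AddCommMonoid M] (N : ℕ) (w : ℕ → M) :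
    ∑ p ∈ primesUpTo N, w p = ∑ p ∈ (Ioc 0 N).filter Nat.Prime, w p :=
  sum_subtype_eq_sum_filter _

theorem tsum_primes_div_pow_eq_sum (w : ℕ → ℂ) {k : ℕ} (hk : k ≠ 0) (N : ℕ) :
    ∑' p : Nat.Primes, w p * ((N / (p : ℕ) : ℕ) : ℂ) ^ k =
      ∑ p ∈ (Ioc 0 N).filter Nat.Prime, w p * ((N / p : ℕ) : ℂ) ^ k := by
  rw [← sum_primesUpTo N fun p => w p * ((N / p : ℕ) : ℂ) ^ k]
  refine tsum_eq_sum fun p hp => ?_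
  have : N < (p : ℕ) := not_le.1 (mt mem_primesUpTo.2 hp)
  rw [Nat.div_eq_of_lt this, Nat.cast_zero, zero_pow hk, mul_zero]

/-- The exponent 1, where the increment is exactly p, is split off. Full series replace the finite
sums at no cost, since ⌊x⌋ / q = 0 once q > x and k ≠ 0. -/
theorem gcdSum_eq_tsum_add_tsum {f : ℕ → ℂ} (hf : IsAdditiveArith f)
    (hfp : ∀ p : ℕ, p.Prime → f p = (p : ℂ)) {k : ℕ} (hk : k ≠ 0) (x : ℝ) :
    gcdSum f k x = ∑' p : Nat.Primes, ((p : ℕ) : ℂ) * ((⌊x⌋₊ / (p : ℕ) : ℕ) : ℂ) ^ k +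
      ∑' z : Nat.Primes × ℕ, primePowIncrement f z.1 (z.2 + 1) *
        ((⌊x⌋₊ / (z.1 : ℕ) ^ (z.2 + 2) : ℕ) : ℂ) ^ k := by
  rw [gcdSum_eq_sum_sum hf hk]
  set N := ⌊x⌋₊
  simp only [sum_range_succ']
  rw [sum_add_distrib, add_comm, tsum_primes_div_pow_eq_sum (fun p => (p : ℂ)) hk]
  congr 1
  · refine sum_congr rfl fun p hp => ?_
    rw [primePowIncrement, zero_add, pow_one, pow_zero, hf.map_one, sub_zero,
      hfp p (mem_filter.1 hp).2]
  · rw [← sum_primesUpTo N fun p => ∑ i ∈ range N, primePowIncrement f p (i + 1) *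
      ((N / p ^ (i + 1 + 1) : ℕ) : ℂ) ^ k, ← sum_product']
    symm
    refine tsum_eq_sum fun z hz => ?_
    obtain ⟨p, i⟩ := z
    have : N < (p : ℕ) ^ (i + 2) := by
      by_contra h
      push Not at h
      apply hz
      rw [mem_product, mem_primesUpTo, mem_range]
      have h1 : (p : ℕ) ≤ (p : ℕ) ^ (i + 2) := Nat.le_self_pow (by omega) _
      have h2 : i + 2 < (p : ℕ) ^ (i + 2) := Nat.lt_pow_self p.2.one_lt
      exact ⟨h1.trans h, by dsimp only; omega⟩
    dsimp only
    rw [Nat.div_eq_of_lt this, Nat.cast_zero, zero_pow hk, mul_zero]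

theorem abs_floor_pow_sub_pow_le {y : ℝ} (hy : 0 ≤ y) (k : ℕ) :
    |(⌊y⌋₊ : ℝ) ^ (k + 1) - y ^ (k + 1)| ≤ (k + 1) * y ^ k := by
  have h1 := Nat.floor_le hy
  have h2 := Nat.lt_floor_add_one y
  rw [abs_sub_comm, abs_of_nonneg (sub_nonneg.2 (by gcongr))]
  induction k with
  | zero => simp; linarith
  | succ k ih =>
    have e : y ^ (k + 1 + 1) - (⌊y⌋₊ : ℝ) ^ (k + 1 + 1) =
      y * (y ^ (k + 1) - (⌊y⌋₊ : ℝ) ^ (k + 1)) + (⌊y⌋₊ : ℝ) ^ (k + 1) * (y - ⌊y⌋₊) := by ring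
    have a : y * (y ^ (k + 1) - (⌊y⌋₊ : ℝ) ^ (k + 1)) ≤ y * ((k + 1) * y ^ k) := by gcongr
    have b : (⌊y⌋₊ : ℝ) ^ (k + 1) * (y - ⌊y⌋₊) ≤ y ^ (k + 1) * 1 := by
      gcongr
      linarith
    rw [e]
    push_cast
    calc _ ≤ y * ((k + 1) * y ^ k) + y ^ (k + 1) * 1 := add_le_add a b
      _ = _ := by ring

/-- The natural bound 2y has exponent 1, too small for the sum over proper prime powers, which needs
more than 3/2. The exponent is raised to 7/4, still below 2; for y < 1 the floor vanishes and y² ≤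
y^(7/4). -/
theorem abs_floor_sq_sub_sq_le {y : ℝ} (hy : 0 ≤ y) :
    |(⌊y⌋₊ : ℝ) ^ 2 - y ^ 2| ≤ 2 * y ^ (7 / 4 : ℝ) := by
  rcases lt_or_ge y 1 with h | h
  · rw [Nat.floor_eq_zero.2 h]
    have : y ^ 2 ≤ y ^ (7 / 4 : ℝ) := by
      rcases hy.eq_or_lt with rfl | hy
      · norm_num
      rw [← Real.rpow_natCast]
      exact Real.rpow_le_rpow_of_exponent_ge hy h.le (by norm_num)
    have h0 : 0 ≤ y ^ 2 := by positivity
    simp only [Nat.cast_zero, ne_eq, OfNat.ofNat_ne_zero, not_false_eq_true, zero_pow, zero_sub,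
      abs_neg, abs_of_nonneg h0]
    linarith
  · have h1 := abs_floor_pow_sub_pow_le hy 1
    have h2 : y ≤ y ^ (7 / 4 : ℝ) := by
      conv_lhs => rw [← Real.rpow_one y]
      exact Real.rpow_le_rpow_of_exponent_le h (by norm_num)
    norm_num at h1
    linarith

/-- Apply `hc` with y = x / q i and sum. Because `hc` covers small y as well, the terms with q i > x
need no separate tail estimate. -/
theorem norm_tsum_floor_pow_sub_le {ι : Type*} (w : ι → ℂ) (q : ι → ℕ) {k : ℕ}
    {c τ : ℝ} (h1 : Summable fun i => w i / (q i : ℂ) ^ k)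
    (h2 : Summable fun i => ‖w i‖ * (q i : ℝ) ^ (-τ))
    (hc : ∀ y : ℝ, 0 ≤ y → |(⌊y⌋₊ : ℝ) ^ k - y ^ k| ≤ c * y ^ τ) :
    ∃ A : ℝ, 0 ≤ A ∧ ∀ x : ℝ, 0 ≤ x → ‖∑' i, w i * ((⌊x⌋₊ / q i : ℕ) : ℂ) ^ k -
      (x : ℂ) ^ k * ∑' i, w i / (q i : ℂ) ^ k‖ ≤ A * x ^ τ := by
  have hc0 : 0 ≤ c := by simpa using (abs_nonneg _).trans (hc 1 zero_le_one)
  refine ⟨c * ∑' i, ‖w i‖ * (q i : ℝ) ^ (-τ),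
    mul_nonneg hc0 (tsum_nonneg fun i => by positivity), fun x hx => ?_⟩
  have hb : ∀ i, ‖w i * ((⌊x⌋₊ / q i : ℕ) : ℂ) ^ k - (x : ℂ) ^ k * (w i / (q i : ℂ) ^ k)‖ ≤
      c * x ^ τ * (‖w i‖ * (q i : ℝ) ^ (-τ)) := by
    intro i
    have e : w i * ((⌊x⌋₊ / q i : ℕ) : ℂ) ^ k - (x : ℂ) ^ k * (w i / (q i : ℂ) ^ k) =
        w i * (((⌊x / q i⌋₊ : ℝ) ^ k - (x / q i) ^ k : ℝ) : ℂ) := by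
      rw [Nat.floor_div_natCast]
      push_cast
      ring
    rw [e, norm_mul, Complex.norm_real, Real.norm_eq_abs]
    have := hc (x / q i) (by positivity)
    rw [Real.div_rpow hx (by positivity), div_eq_mul_inv (x ^ τ),
      ← Real.rpow_neg (by positivity)] at this
    calc _ ≤ ‖w i‖ * (c * (x ^ τ * (q i : ℝ) ^ (-τ))) := by gcongr
      _ = _ := by ring
  have hsb := h2.mul_left (c * x ^ τ)
  have hsd := Summable.of_norm_bounded hsb hb
  have hs1 := h1.mul_left ((x : ℂ) ^ k)
  have hs : Summable fun i => w i * ((⌊x⌋₊ / q i : ℕ) : ℂ) ^ k :=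
    (hsd.add hs1).congr fun i => by ring
  rw [← tsum_mul_left, ← hs.tsum_sub hs1]
  refine (tsum_of_norm_bounded hsb.hasSum hb).trans_eq ?_
  rw [tsum_mul_left]
  ring

theorem summable_primes_div_pow {k : ℕ} (hk : 3 ≤ k) :
    Summable (fun p : Nat.Primes => ((p : ℕ) : ℂ) / ((p : ℕ) : ℂ) ^ k) := by
  have hk' : (3 : ℝ) ≤ k := by exact_mod_cast hk
  refine Summable.of_norm (((Nat.Primes.summable_rpow (r := 1 - k)).2 (by linarith)).congr fun p => ?_)
  have hp : (0 : ℝ) < (p : ℕ) := by exact_mod_cast p.2.pos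
  rw [norm_div, norm_pow, Complex.norm_natCast, Real.rpow_sub hp, Real.rpow_one, Real.rpow_natCast]

namespace IsAlladiErdosType

variable {f : ℕ → ℂ}

theorem exists_norm_primePow_le (hf : IsAlladiErdosType f) :
    ∃ (l : ℕ) (C : ℝ), 0 ≤ C ∧ ∀ p : ℕ, p.Prime → ∀ i : ℕ,
      ‖f (p ^ (i + 1))‖ ≤ C * ((i + 1 : ℝ) ^ l * (p : ℝ) ^ (i + 1)) := by
  obtain ⟨l, C, h⟩ := hf.bound
  refine ⟨l, max C 1, by positivity, fun p hp i => ?_⟩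
  rcases Nat.eq_zero_or_pos i with rfl | hi
  · simp only [zero_add, pow_one, hf.map_prime p hp, Complex.norm_natCast, Nat.cast_zero, one_pow,
      one_mul]
    exact le_mul_of_one_le_left (Nat.cast_nonneg _) (le_max_right _ _)
  · have := h p hp (i + 1) (by omega)
    push_cast at this
    refine this.trans ?_
    gcongr
    exact le_max_left _ _

theorem exists_norm_primePowIncrement_le (hf : IsAlladiErdosType f) :
    ∃ (l : ℕ) (C : ℝ), 0 ≤ C ∧ ∀ p : ℕ, p.Prime → ∀ i : ℕ,
      ‖primePowIncrement f p (i + 1)‖ ≤ C * ((i + 2 : ℝ) ^ l * (p : ℝ) ^ (i + 2)) := by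
  obtain ⟨l, C, hC, h⟩ := hf.exists_norm_primePow_le
  refine ⟨l, 2 * C, by positivity, fun p hp i => ?_⟩
  have h1 := h p hp (i + 1)
  have h2 := h p hp i
  push_cast at h1
  have hp1 : (1 : ℝ) ≤ p := by exact_mod_cast hp.one_le
  have e : (i : ℝ) + 1 + 1 = i + 2 := by ring
  rw [e] at h1
  have h3 : C * ((i + 1 : ℝ) ^ l * (p : ℝ) ^ (i + 1)) ≤ C * ((i + 2 : ℝ) ^ l * (p : ℝ) ^ (i + 2)) := by
    gcongr ?_ * (?_ ^ l * ?_)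
    · linarith
    · exact pow_le_pow_right₀ hp1 (by omega)
  rw [primePowIncrement]
  refine (norm_sub_le _ _).trans ?_
  linarith

/-- The increment is O(ν^l q), so the effective exponent is τ - 1, which must exceed 1/2 for proper
prime powers. -/
theorem summable_norm_primePowIncrement_mul_rpow (hf : IsAlladiErdosType f) {τ : ℝ}
    (hτ : 3 / 2 < τ) :
    Summable (fun z : Nat.Primes × ℕ => ‖primePowIncrement f z.1 (z.2 + 1)‖ *
      (((z.1 : ℕ) ^ (z.2 + 2) : ℕ) : ℝ) ^ (-τ)) := by
  obtain ⟨l, C, hC, h⟩ := hf.exists_norm_primePowIncrement_le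
  refine ((summable_pow_mul_properPrimePow_rpow l (σ := τ - 1) (by linarith)).mul_left C).of_nonneg_of_le
    (fun z => by positivity) ?_
  rintro ⟨p, i⟩
  dsimp only
  have hp : (0 : ℝ) < (p : ℕ) := by exact_mod_cast p.2.pos
  push_cast
  have hq : (0 : ℝ) < ((p : ℕ) : ℝ) ^ (i + 2) := by positivity
  have e : (((p : ℕ) : ℝ) ^ (i + 2)) ^ (-(τ - 1)) =
      ((p : ℕ) : ℝ) ^ (i + 2) * (((p : ℕ) : ℝ) ^ (i + 2)) ^ (-τ) := by
    rw [neg_sub, sub_eq_add_neg, Real.rpow_add hq, Real.rpow_one]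
  rw [e]
  calc _ ≤ C * ((i + 2 : ℝ) ^ l * ((p : ℕ) : ℝ) ^ (i + 2)) * (((p : ℕ) : ℝ) ^ (i + 2)) ^ (-τ) := by
        gcongr
        exact h p p.2 i
    _ = _ := by ring

theorem summable_norm_primePowIncrement_div (hf : IsAlladiErdosType f) {k : ℕ} (hk : 2 ≤ k) :
    Summable (fun z : Nat.Primes × ℕ => ‖primePowIncrement f z.1 (z.2 + 1) /
      (((z.1 : ℕ) ^ (z.2 + 2) : ℕ) : ℂ) ^ k‖) := by
  have hk' : (2 : ℝ) ≤ k := by exact_mod_cast hk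
  refine (hf.summable_norm_primePowIncrement_mul_rpow (τ := k) (by linarith)).congr fun z => ?_
  rw [norm_div, norm_pow, Complex.norm_natCast, Real.rpow_neg (by positivity), Real.rpow_natCast,
    div_eq_mul_inv]

theorem summable_norm_primePowTerm (hf : IsAlladiErdosType f) {k p : ℕ} (hk : 2 ≤ k)
    (hp : p.Prime) : Summable (fun i : ℕ => ‖primePowTerm f k p i‖) := by
  obtain ⟨l, C, hC, h⟩ := hf.exists_norm_primePow_le
  have hp2 : (2 : ℝ) ≤ p := by exact_mod_cast hp.two_le
  have h1 := summable_pow_mul_geometric_of_norm_lt_one l (r := (1 / 2 : ℝ)) (by norm_num)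
  refine (((summable_nat_add_iff 1).2 h1).mul_left C).of_nonneg_of_le (fun i => norm_nonneg _)
    fun i => ?_
  rw [primePowTerm, norm_div, norm_pow, Complex.norm_natCast]
  push_cast
  have h2 : (p : ℝ) ^ (i + 1) * 2 ^ (i + 1) ≤ (p : ℝ) ^ ((i + 1) * k) := by
    calc (p : ℝ) ^ (i + 1) * 2 ^ (i + 1) ≤ (p : ℝ) ^ (i + 1) * (p : ℝ) ^ (i + 1) := by gcongr
      _ = (p : ℝ) ^ ((i + 1) * 2) := by ring
      _ ≤ _ := by
        gcongr
        · linarith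
  rw [div_le_iff₀ (by positivity)]
  calc _ ≤ C * ((i + 1 : ℝ) ^ l * (p : ℝ) ^ (i + 1)) := h p hp i
    _ = C * ((i + 1 : ℝ) ^ l * (1 / 2) ^ (i + 1)) * ((p : ℝ) ^ (i + 1) * 2 ^ (i + 1)) := by
      rw [one_div, inv_pow]; field_simp
    _ ≤ _ := by gcongr

/-- Multiplication by 1 - p^(-k) subtracts the series shifted by one exponent, which turns values of
f into increments. -/
theorem localTerm_eq (hf : IsAlladiErdosType f) {k p : ℕ} (hk : 2 ≤ k) (hp : p.Prime) :
    localTerm f k p = (p : ℂ) / (p : ℂ) ^ k +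
      ∑' i : ℕ, primePowIncrement f p (i + 1) / ((p ^ (i + 2) : ℕ) : ℂ) ^ k := by
  have hs := (hf.summable_norm_primePowTerm hk hp).of_norm
  have hs1 := (summable_nat_add_iff 1).2 hs
  have hs2 := hs.mul_left (1 / (p : ℂ) ^ k)
  have hp0 : (p : ℂ) ≠ 0 := by exact_mod_cast hp.ne_zero
  have e : ∀ i : ℕ, primePowIncrement f p (i + 1) / ((p ^ (i + 2) : ℕ) : ℂ) ^ k =
      primePowTerm f k p (i + 1) - 1 / (p : ℂ) ^ k * primePowTerm f k p i := by
    intro i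
    rw [primePowIncrement, primePowTerm, primePowTerm, div_mul_div_comm, one_mul, ← pow_add,
      sub_div]
    push_cast
    rw [← pow_mul]
    congr 2
    ring
  rw [tsum_congr e, hs1.tsum_sub hs2, tsum_mul_left, localTerm, hs.tsum_eq_zero_add]
  have h0 : primePowTerm f k p 0 = (p : ℂ) / (p : ℂ) ^ k := by
    simp [primePowTerm, hf.map_prime p hp]
  rw [h0]
  ring

/-- The contribution of the exponents `ν ≥ 2` to the local terms may be summed over the primes and
the exponents in one step. -/
theorem hasSum_tsum_primePowIncrement_div (hf : IsAlladiErdosType f) {k : ℕ} (hk : 2 ≤ k) :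
    HasSum (fun p : Nat.Primes => ∑' i : ℕ, primePowIncrement f p (i + 1) /
        (((p : ℕ) ^ (i + 2) : ℕ) : ℂ) ^ k)
      (∑' z : Nat.Primes × ℕ, primePowIncrement f z.1 (z.2 + 1) /
        (((z.1 : ℕ) ^ (z.2 + 2) : ℕ) : ℂ) ^ k) := by
  have hs := (hf.summable_norm_primePowIncrement_div hk).of_norm
  exact hs.hasSum.prod_fiberwise fun p => (hs.prod_factor p).hasSum

theorem summable_norm_tsum_primePowIncrement_div (hf : IsAlladiErdosType f) {k : ℕ} (hk : 2 ≤ k) :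
    Summable (fun p : Nat.Primes => ‖∑' i : ℕ, primePowIncrement f p (i + 1) /
        (((p : ℕ) ^ (i + 2) : ℕ) : ℂ) ^ k‖) := by
  have hs := hf.summable_norm_primePowIncrement_div hk
  refine hs.prod.of_nonneg_of_le (fun p => norm_nonneg _) fun p => ?_
  exact norm_tsum_le_tsum_norm (hs.prod_factor p)

/-- For k = 2 the exponent-one part is 1/p, not summable over the primes; paired with log(1 - 1/p)
it becomes the summand of Mertens' constant. -/
theorem localTermTwo_eq (hf : IsAlladiErdosType f) (p : Nat.Primes) :
    localTermTwo f p =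
      ((Real.log (1 - 1 / ((p : ℕ) : ℝ)) + 1 / ((p : ℕ) : ℝ) : ℝ) : ℂ) +
      ∑' i : ℕ, primePowIncrement f p (i + 1) / (((p : ℕ) ^ (i + 2) : ℕ) : ℂ) ^ 2 := by
  have hp0 : ((p : ℕ) : ℂ) ≠ 0 := by exact_mod_cast p.2.ne_zero
  rw [localTermTwo, hf.localTerm_eq le_rfl p.2]
  have : ((p : ℕ) : ℂ) / ((p : ℕ) : ℂ) ^ 2 = 1 / ((p : ℕ) : ℂ) := by field_simp
  rw [this]
  push_cast
  ring

theorem summable_norm_localTermTwo (hf : IsAlladiErdosType f) :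
    Summable (fun p : Nat.Primes => ‖localTermTwo f p‖) := by
  have h1 := hasSum_log_one_sub_add_one_div.summable.norm
  refine (h1.add (hf.summable_norm_tsum_primePowIncrement_div le_rfl)).of_nonneg_of_le
    (fun p => norm_nonneg _) fun p => ?_
  rw [hf.localTermTwo_eq, ← Complex.norm_real]
  exact norm_add_le _ _

theorem gcdConstTwo_eq (hf : IsAlladiErdosType f) :
    gcdConstTwo f = ((Real.eulerMascheroniConstant + ∑' p : Nat.Primes,
      (Real.log (1 - 1 / ((p : ℕ) : ℝ)) + 1 / ((p : ℕ) : ℝ)) : ℝ) : ℂ) +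
      ∑' z : Nat.Primes × ℕ, primePowIncrement f z.1 (z.2 + 1) /
        (((z.1 : ℕ) ^ (z.2 + 2) : ℕ) : ℂ) ^ 2 := by
  have h1 := Complex.hasSum_ofReal.2 hasSum_log_one_sub_add_one_div.summable.hasSum
  have h2 := h1.add (hf.hasSum_tsum_primePowIncrement_div le_rfl)
  rw [gcdConstTwo, tsum_congr hf.localTermTwo_eq, h2.tsum_eq, Complex.ofReal_add, add_assoc]

theorem summable_norm_localTerm (hf : IsAlladiErdosType f) {k : ℕ} (hk : 3 ≤ k) :
    Summable (fun p : Nat.Primes => ‖localTerm f k p‖) := by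
  refine ((summable_primes_div_pow hk).norm.add
    (hf.summable_norm_tsum_primePowIncrement_div (k := k) (by omega))).of_nonneg_of_le
    (fun p => norm_nonneg _) fun p => ?_
  rw [hf.localTerm_eq (by omega) p.2]
  exact norm_add_le _ _

theorem gcdConst_eq (hf : IsAlladiErdosType f) {k : ℕ} (hk : 3 ≤ k) :
    gcdConst f k = ∑' p : Nat.Primes, ((p : ℕ) : ℂ) / ((p : ℕ) : ℂ) ^ k +
      ∑' z : Nat.Primes × ℕ, primePowIncrement f z.1 (z.2 + 1) /
        (((z.1 : ℕ) ^ (z.2 + 2) : ℕ) : ℂ) ^ k := by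
  have h2 := (summable_primes_div_pow hk).hasSum.add
    (hf.hasSum_tsum_primePowIncrement_div (k := k) (by omega))
  rw [gcdConst, ← h2.tsum_eq]
  exact tsum_congr fun p => hf.localTerm_eq (by omega) p.2

end IsAlladiErdosType

end GcdSum

/-! ### Error terms for the prime part, and assembly of the three cases. -/

section Asymptotics

open Finset Filter Topology

theorem card_filter_prime_Ioc (N : ℕ) : ((Ioc 0 N).filter Nat.Prime).card = N.primeCounting := by
  rw [← Nat.primesLE_card_eq_primeCounting]
  congr 1
  ext p
  simp only [mem_filter, mem_Ioc, Nat.mem_primesLE]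
  constructor
  · exact fun h => ⟨h.1.2, h.2⟩
  · exact fun h => ⟨⟨h.2.pos, h.1⟩, h.2⟩

theorem norm_prime_mul_floor_pow_sub_le {x : ℝ} (hx : 0 ≤ x) (p j : ℕ) :
    ‖(p : ℂ) * ((⌊x⌋₊ / p : ℕ) : ℂ) ^ (j + 1) - (x : ℂ) ^ (j + 1) * ((p : ℂ) / (p : ℂ) ^ (j + 1))‖ ≤
      p * ((j + 1) * (x / p) ^ j) := by
  have e : (p : ℂ) * ((⌊x⌋₊ / p : ℕ) : ℂ) ^ (j + 1) -
      (x : ℂ) ^ (j + 1) * ((p : ℂ) / (p : ℂ) ^ (j + 1)) =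
      (p : ℂ) * (((⌊x / p⌋₊ : ℝ) ^ (j + 1) - (x / p) ^ (j + 1) : ℝ) : ℂ) := by
    rw [Nat.floor_div_natCast]
    push_cast
    ring
  rw [e, norm_mul, Complex.norm_real, Complex.norm_natCast, Real.norm_eq_abs]
  gcongr
  exact abs_floor_pow_sub_pow_le (by positivity) j

/-- Each prime p ≤ x contributes an error of at most p · 2(x/p) = 2x, independent of p. -/
theorem norm_tsum_primes_sq_sub_le {x : ℝ} (hx : 0 ≤ x) :
    ‖∑' p : Nat.Primes, ((p : ℕ) : ℂ) * ((⌊x⌋₊ / (p : ℕ) : ℕ) : ℂ) ^ 2 -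
      (x : ℂ) ^ 2 * ((∑ p ∈ (Ioc 0 ⌊x⌋₊).filter Nat.Prime, 1 / (p : ℝ) : ℝ) : ℂ)‖ ≤
      2 * x * (⌊x⌋₊.primeCounting : ℝ) := by
  rw [tsum_primes_div_pow_eq_sum (fun p => (p : ℂ)) two_ne_zero, Complex.ofReal_sum, mul_sum,
    ← sum_sub_distrib]
  refine (norm_sum_le _ _).trans ?_
  rw [← card_filter_prime_Ioc, mul_comm, ← nsmul_eq_mul]
  refine sum_le_card_nsmul _ _ _ fun p hp => ?_
  have hp0 : (p : ℂ) ≠ 0 := by exact_mod_cast (mem_filter.1 hp).2.ne_zero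
  have hp0' : (p : ℝ) ≠ 0 := by exact_mod_cast (mem_filter.1 hp).2.ne_zero
  have h := norm_prime_mul_floor_pow_sub_le hx p 1
  have e : ((1 / (p : ℝ) : ℝ) : ℂ) = (p : ℂ) / (p : ℂ) ^ (1 + 1) := by
    push_cast
    field_simp
  rw [e]
  refine h.trans_eq ?_
  push_cast
  field_simp
  ring

theorem norm_tsum_primes_div_cube_sub_le {N : ℕ} (hN : 0 < N) :
    ‖∑ p ∈ (Ioc 0 N).filter Nat.Prime, (p : ℂ) / (p : ℂ) ^ 3 -
      ∑' p : Nat.Primes, ((p : ℕ) : ℂ) / ((p : ℕ) : ℂ) ^ 3‖ ≤ 1 / N := by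
  set g : ℕ → ℝ := fun p => (p : ℝ) / (p : ℝ) ^ 3 with hg
  have hg0 : ∀ p, 0 ≤ g p := fun p => by positivity
  have hs : Summable fun p : Nat.Primes => g p := by
    refine (summable_primes_div_pow le_rfl).norm.congr fun p => ?_
    rw [norm_div, norm_pow, Complex.norm_natCast]
  have key : ∀ M, N ≤ M → ∑ p ∈ primesUpTo M, g p ≤ ∑ p ∈ primesUpTo N, g p + 1 / N := by
    intro M hM
    rw [sum_primesUpTo, sum_primesUpTo, sum_filter, sum_filter,
      ← sum_Ioc_consecutive _ (Nat.zero_le N) hM]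
    gcongr
    calc ∑ i ∈ Ioc N M, (if i.Prime then g i else 0) ≤ ∑ i ∈ Ioc N M, ((i : ℝ) ^ 2)⁻¹ := by
          refine sum_le_sum fun i hi => ?_
          have : 0 < i := by have := (mem_Ioc.1 hi).1; omega
          split_ifs
          · apply le_of_eq
            rw [hg]
            field_simp
          · positivity
      -- Primality is dropped here: the tail over all integers is already small enough.
      _ ≤ (N : ℝ)⁻¹ - (M : ℝ)⁻¹ := sum_Ioc_inv_sq_le_sub hN.ne' hM
      _ ≤ 1 / N := by
          rw [one_div]
          have : 0 ≤ (M : ℝ)⁻¹ := by positivity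
          linarith
  have hup : ∑' p : Nat.Primes, g p ≤ ∑ p ∈ primesUpTo N, g p + 1 / N := by
    refine hs.tsum_le_of_sum_le fun t => ?_
    refine (sum_le_sum_of_subset_of_nonneg (fun p hp => ?_) fun _ _ _ => hg0 _).trans
      (key (max N (t.sup fun p => (p : ℕ))) (le_max_left _ _))
    exact mem_primesUpTo.2 ((le_sup (f := fun p : Nat.Primes => (p : ℕ)) hp).trans (le_max_right _ _))
  have hlo : ∑ p ∈ primesUpTo N, g p ≤ ∑' p : Nat.Primes, g p :=
    hs.sum_le_tsum _ fun _ _ => hg0 _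
  have e1 : ∑' p : Nat.Primes, ((p : ℕ) : ℂ) / ((p : ℕ) : ℂ) ^ 3 =
      ((∑' p : Nat.Primes, g p : ℝ) : ℂ) := by
    rw [Complex.ofReal_tsum]
    refine tsum_congr fun p => ?_
    rw [hg]; push_cast; rfl
  have e2 : ∑ p ∈ (Ioc 0 N).filter Nat.Prime, (p : ℂ) / (p : ℂ) ^ 3 =
      ((∑ p ∈ primesUpTo N, g p : ℝ) : ℂ) := by
    rw [sum_primesUpTo, Complex.ofReal_sum]
    refine sum_congr rfl fun p _ => ?_
    rw [hg]; push_cast; rfl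
  rw [e1, e2, ← Complex.ofReal_sub, Complex.norm_real, Real.norm_eq_abs, abs_sub_comm,
    abs_of_nonneg (by linarith)]
  linarith

/-- The general comparison with τ = 2 would need ∑ 1/p to converge, so the series is cut at x:
floors cost 3x²/p for each p ≤ x, and the omitted tail costs x³ / ⌊x⌋ ≤ 2x². -/
theorem norm_tsum_primes_cube_sub_le {x : ℝ} (hx : 1 ≤ x) :
    ‖∑' p : Nat.Primes, ((p : ℕ) : ℂ) * ((⌊x⌋₊ / (p : ℕ) : ℕ) : ℂ) ^ 3 -
      (x : ℂ) ^ 3 * ∑' p : Nat.Primes, ((p : ℕ) : ℂ) / ((p : ℕ) : ℂ) ^ 3‖ ≤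
      3 * x ^ 2 * ∑ p ∈ (Ioc 0 ⌊x⌋₊).filter Nat.Prime, 1 / (p : ℝ) + 2 * x ^ 2 := by
  have hx0 : 0 ≤ x := by linarith
  have hN : 0 < ⌊x⌋₊ := Nat.floor_pos.2 hx
  have hN' : (1 : ℝ) ≤ ⌊x⌋₊ := by exact_mod_cast hN
  have h1 := norm_tsum_primes_div_cube_sub_le hN
  rw [tsum_primes_div_pow_eq_sum (fun p => (p : ℂ)) three_ne_zero]
  set S := ∑' p : Nat.Primes, ((p : ℕ) : ℂ) / ((p : ℕ) : ℂ) ^ 3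
  set T := ∑ p ∈ (Ioc 0 ⌊x⌋₊).filter Nat.Prime, (p : ℂ) / (p : ℂ) ^ 3 with hT
  set P := ∑ p ∈ (Ioc 0 ⌊x⌋₊).filter Nat.Prime, (p : ℂ) * ((⌊x⌋₊ / p : ℕ) : ℂ) ^ 3 with hP
  have h2 : ‖P - (x : ℂ) ^ 3 * T‖ ≤
      3 * x ^ 2 * ∑ p ∈ (Ioc 0 ⌊x⌋₊).filter Nat.Prime, 1 / (p : ℝ) := by
    rw [hP, hT, mul_sum, ← sum_sub_distrib, mul_sum]
    refine (norm_sum_le _ _).trans (sum_le_sum fun p hp => ?_)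
    have hp0' : (p : ℝ) ≠ 0 := by exact_mod_cast (mem_filter.1 hp).2.ne_zero
    refine (norm_prime_mul_floor_pow_sub_le hx0 p 2).trans_eq ?_
    push_cast
    field_simp
    ring
  have h3 : ‖(x : ℂ) ^ 3 * (T - S)‖ ≤ 2 * x ^ 2 := by
    rw [norm_mul, norm_pow, Complex.norm_real, Real.norm_of_nonneg hx0]
    have := (Nat.lt_floor_add_one x).le
    have h4 : 1 / (⌊x⌋₊ : ℝ) ≤ 2 / x := by
      rw [div_le_div_iff₀ (by linarith) (by linarith)]
      linarith
    calc x ^ 3 * ‖T - S‖ ≤ x ^ 3 * (2 / x) := by gcongr; exact h1.trans h4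
      _ = 2 * x ^ 2 := by field_simp
  have e : P - (x : ℂ) ^ 3 * S = (P - (x : ℂ) ^ 3 * T) + (x : ℂ) ^ 3 * (T - S) := by ring
  rw [e]
  exact (norm_add_le _ _).trans (add_le_add h2 h3)

/-- The contribution of the proper prime powers to the sum over the greatest common divisors, up to
an error `O(x ^ τ)`. -/
theorem IsAlladiErdosType.isBigO_tsum_properPrimePow_sub {f : ℕ → ℂ} (hf : IsAlladiErdosType f)
    {k : ℕ} (hk : 2 ≤ k) {c τ : ℝ} (hτ : 3 / 2 < τ)
    (hc : ∀ y : ℝ, 0 ≤ y → |(⌊y⌋₊ : ℝ) ^ k - y ^ k| ≤ c * y ^ τ) :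
    (fun x : ℝ => ∑' z : Nat.Primes × ℕ, primePowIncrement f z.1 (z.2 + 1) *
        ((⌊x⌋₊ / (z.1 : ℕ) ^ (z.2 + 2) : ℕ) : ℂ) ^ k -
      (x : ℂ) ^ k * ∑' z : Nat.Primes × ℕ, primePowIncrement f z.1 (z.2 + 1) /
        (((z.1 : ℕ) ^ (z.2 + 2) : ℕ) : ℂ) ^ k) =O[atTop] fun x : ℝ => x ^ τ := by
  obtain ⟨A, hA, h⟩ := norm_tsum_floor_pow_sub_le
    (fun z : Nat.Primes × ℕ => primePowIncrement f z.1 (z.2 + 1))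
    (fun z : Nat.Primes × ℕ => (z.1 : ℕ) ^ (z.2 + 2))
    (hf.summable_norm_primePowIncrement_div hk).of_norm
    (hf.summable_norm_primePowIncrement_mul_rpow hτ) hc
  refine Asymptotics.IsBigO.of_bound A ?_
  filter_upwards [eventually_ge_atTop 0] with x hx
  rw [Real.norm_of_nonneg (by positivity : 0 ≤ x ^ τ)]
  exact h x hx

/-- Here the general comparison applies with τ = j, because ∑ p^(1-j) converges for j ≥ 3. -/
theorem isBigO_tsum_primes_sub {j : ℕ} (hj : 3 ≤ j) :
    (fun x : ℝ => ∑' p : Nat.Primes, ((p : ℕ) : ℂ) * ((⌊x⌋₊ / (p : ℕ) : ℕ) : ℂ) ^ (j + 1) -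
      (x : ℂ) ^ (j + 1) * ∑' p : Nat.Primes, ((p : ℕ) : ℂ) / ((p : ℕ) : ℂ) ^ (j + 1))
        =O[atTop] fun x : ℝ => x ^ j := by
  have hj' : (3 : ℝ) ≤ j := by exact_mod_cast hj
  obtain ⟨A, hA, h⟩ := norm_tsum_floor_pow_sub_le (k := j + 1) (c := j + 1) (τ := j)
    (fun p : Nat.Primes => ((p : ℕ) : ℂ)) (fun p : Nat.Primes => (p : ℕ))
    (summable_primes_div_pow (by omega))
    (((Nat.Primes.summable_rpow (r := 1 - j)).2 (by linarith)).congr fun p => by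
      have hp : (0 : ℝ) < (p : ℕ) := by exact_mod_cast p.2.pos
      rw [Complex.norm_natCast, sub_eq_add_neg, Real.rpow_add hp, Real.rpow_one])
    (fun y hy => by rw [Real.rpow_natCast]; exact abs_floor_pow_sub_pow_le hy j)
  refine Asymptotics.IsBigO.of_bound A ?_
  filter_upwards [eventually_ge_atTop 0] with x hx
  rw [Real.norm_of_nonneg (by positivity : 0 ≤ x ^ j)]
  simpa only [Real.rpow_natCast] using h x hx

theorem isBigO_mul_primeCounting :
    (fun x : ℝ => 2 * x * (⌊x⌋₊.primeCounting : ℝ)) =O[atTop] fun x : ℝ => x ^ 2 / Real.log x := by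
  refine Asymptotics.IsBigO.of_bound (2 * (Real.log 4 + 1)) ?_
  filter_upwards [Chebyshev.eventually_primeCounting_le one_pos, eventually_gt_atTop 1] with x h hx
  have hl : 0 < Real.log x := Real.log_pos hx
  rw [Real.norm_of_nonneg (by positivity), Real.norm_of_nonneg (by positivity)]
  calc 2 * x * (⌊x⌋₊.primeCounting : ℝ) ≤ 2 * x * ((Real.log 4 + 1) * x / Real.log x) := by gcongr
    _ = _ := by ring

theorem isBigO_rpow_sq_div_log :
    (fun x : ℝ => x ^ (7 / 4 : ℝ)) =O[atTop] fun x : ℝ => x ^ 2 / Real.log x := by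
  refine Asymptotics.IsBigO.of_bound 4 ?_
  filter_upwards [eventually_gt_atTop 1] with x hx
  have hl : 0 < Real.log x := Real.log_pos hx
  have hx0 : 0 < x := by linarith
  rw [Real.norm_of_nonneg (by positivity), Real.norm_of_nonneg (by positivity), mul_div_assoc',
    le_div_iff₀ hl]
  have h := Real.log_le_rpow_div hx0.le (show (0 : ℝ) < 1 / 4 by norm_num)
  have e : x ^ 2 = x ^ (7 / 4 : ℝ) * x ^ (1 / 4 : ℝ) := by
    rw [← Real.rpow_add hx0, ← Real.rpow_natCast]; norm_num
  rw [e]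
  calc x ^ (7 / 4 : ℝ) * Real.log x ≤ x ^ (7 / 4 : ℝ) * (x ^ (1 / 4 : ℝ) / (1 / 4)) := by gcongr
    _ = _ := by ring

theorem isBigO_one_log_log : (fun _ : ℝ => (1 : ℝ)) =O[atTop] fun x => Real.log (Real.log x) := by
  have h : Tendsto (fun x => Real.log (Real.log x)) atTop atTop :=
    Real.tendsto_log_atTop.comp Real.tendsto_log_atTop
  exact (Asymptotics.isLittleO_const_left.2 (Or.inr (tendsto_norm_atTop_atTop.comp h))).isBigO

theorem isBigO_sum_prime_one_div :
    (fun x : ℝ => ∑ p ∈ (Ioc 0 ⌊x⌋₊).filter Nat.Prime, 1 / (p : ℝ)) =O[atTop]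
      fun x => Real.log (Real.log x) := by
  have h1 : (fun x : ℝ => 1 / Real.log x) =O[atTop] fun _ => (1 : ℝ) :=
    (Real.tendsto_log_atTop.const_div_atTop 1).isBigO_one ℝ
  set D := Real.eulerMascheroniConstant +
    ∑' p : Nat.Primes, (Real.log (1 - 1 / ((p : ℕ) : ℝ)) + 1 / ((p : ℕ) : ℝ))
  have h2 : (fun _ : ℝ => D) =O[atTop] fun x => Real.log (Real.log x) :=
    (Asymptotics.isBigO_const_const D one_ne_zero _).trans isBigO_one_log_log
  have h3 := ((mertens_second.trans (h1.trans isBigO_one_log_log)).add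
    (Asymptotics.isBigO_refl (fun x => Real.log (Real.log x)) atTop)).add h2
  refine h3.congr_left fun x => ?_
  ring

namespace IsAlladiErdosType

variable {f : ℕ → ℂ}

theorem isBigO_gcdSum_two (hf : IsAlladiErdosType f) :
    (fun x : ℝ => gcdSum f 2 x -
        ((x : ℂ) ^ 2 * ((Real.log (Real.log x) : ℝ) : ℂ) + gcdConstTwo f * (x : ℂ) ^ 2))
      =O[atTop] (fun x : ℝ => x ^ 2 / Real.log x) := by
  have h1 := (hf.isBigO_tsum_properPrimePow_sub le_rfl (τ := 7 / 4) (by norm_num)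
    fun y hy => abs_floor_sq_sub_sq_le hy).trans isBigO_rpow_sq_div_log
  have h2 : (fun x : ℝ => ∑' p : Nat.Primes, ((p : ℕ) : ℂ) * ((⌊x⌋₊ / (p : ℕ) : ℕ) : ℂ) ^ 2 -
      (x : ℂ) ^ 2 * ((∑ p ∈ (Ioc 0 ⌊x⌋₊).filter Nat.Prime, 1 / (p : ℝ) : ℝ) : ℂ)) =O[atTop]
      (fun x : ℝ => x ^ 2 / Real.log x) := by
    refine Asymptotics.IsBigO.trans (Asymptotics.IsBigO.of_bound 1 ?_) isBigO_mul_primeCounting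
    filter_upwards [eventually_ge_atTop 0] with x hx
    rw [one_mul]
    exact (norm_tsum_primes_sq_sub_le hx).trans (le_abs_self _)
  have h3 := Complex.isBigO_ofReal_left.2
    -- Mertens' error O(1/log x), scaled by x², has the same order as the Chebyshev error x π(x).
    ((Asymptotics.isBigO_refl (fun x : ℝ => x ^ 2) atTop).mul mertens_second)
  simp only [mul_one_div] at h3
  refine ((h1.add h2).add h3).congr_left fun x => ?_
  rw [gcdSum_eq_tsum_add_tsum hf.additive hf.map_prime two_ne_zero, hf.gcdConstTwo_eq]
  push_cast
  ring

theorem isBigO_gcdSum_three (hf : IsAlladiErdosType f) :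
    (fun x : ℝ => gcdSum f 3 x - gcdConst f 3 * (x : ℂ) ^ 3)
      =O[atTop] (fun x : ℝ => x ^ 2 * Real.log (Real.log x)) := by
  have hsq : (fun x : ℝ => x ^ 2) =O[atTop] (fun x : ℝ => x ^ 2 * Real.log (Real.log x)) := by
    simpa using (Asymptotics.isBigO_refl (fun x : ℝ => x ^ 2) atTop).mul isBigO_one_log_log
  have h1 := hf.isBigO_tsum_properPrimePow_sub (k := 3) (by norm_num) (c := 3) (τ := (2 : ℕ))
    (by norm_num) fun y hy => by
      rw [Real.rpow_natCast]
      have := abs_floor_pow_sub_pow_le hy 2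
      norm_num at this ⊢
      exact this
  simp only [Real.rpow_natCast] at h1
  have h2 : (fun x : ℝ => ∑' p : Nat.Primes, ((p : ℕ) : ℂ) * ((⌊x⌋₊ / (p : ℕ) : ℕ) : ℂ) ^ 3 -
      (x : ℂ) ^ 3 * ∑' p : Nat.Primes, ((p : ℕ) : ℂ) / ((p : ℕ) : ℂ) ^ 3) =O[atTop]
      (fun x : ℝ => x ^ 2 * Real.log (Real.log x)) := by
    have h3 := (((Asymptotics.isBigO_refl (fun x : ℝ => x ^ 2) atTop).mul
      isBigO_sum_prime_one_div).const_mul_left 3).add (hsq.const_mul_left 2)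
    refine Asymptotics.IsBigO.trans (Asymptotics.IsBigO.of_bound 1 ?_) h3
    filter_upwards [eventually_ge_atTop 1] with x hx
    rw [one_mul, ← mul_assoc]
    exact (norm_tsum_primes_cube_sub_le hx).trans (le_abs_self _)
  refine ((h1.trans hsq).add h2).congr_left fun x => ?_
  rw [gcdSum_eq_tsum_add_tsum hf.additive hf.map_prime three_ne_zero, hf.gcdConst_eq le_rfl]
  ring

theorem isBigO_gcdSum_succ (hf : IsAlladiErdosType f) {j : ℕ} (hj : 3 ≤ j) :
    (fun x : ℝ => gcdSum f (j + 1) x - gcdConst f (j + 1) * (x : ℂ) ^ (j + 1))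
      =O[atTop] (fun x : ℝ => x ^ j) := by
  have hj' : (3 : ℝ) ≤ j := by exact_mod_cast hj
  have h1 := hf.isBigO_tsum_properPrimePow_sub (k := j + 1) (by omega) (c := j + 1) (τ := j)
    (by linarith) fun y hy => by
      rw [Real.rpow_natCast]
      exact abs_floor_pow_sub_pow_le hy j
  simp only [Real.rpow_natCast] at h1
  refine (h1.add (isBigO_tsum_primes_sub hj)).congr_left fun x => ?_
  rw [gcdSum_eq_tsum_add_tsum hf.additive hf.map_prime (by omega), hf.gcdConst_eq (by omega)]
  ring

end IsAlladiErdosType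

end Asymptotics

theorem theorem5 (f : ℕ → ℂ) (hf : IsAlladiErdosType f) :
    -- all the series that occur converge absolutely
    ((∀ k : ℕ, 2 ≤ k → ∀ p : ℕ, p.Prime → Summable (fun i : ℕ => ‖primePowTerm f k p i‖)) ∧
      Summable (fun p : Nat.Primes => ‖localTermTwo f p‖) ∧
      (∀ k : ℕ, 3 ≤ k → Summable (fun p : Nat.Primes => ‖localTerm f k p‖))) ∧
    -- the case of two variables
    ((fun x : ℝ => gcdSum f 2 x -
        ((x : ℂ) ^ 2 * ((Real.log (Real.log x) : ℝ) : ℂ) + gcdConstTwo f * (x : ℂ) ^ 2))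
      =O[Filter.atTop] (fun x : ℝ => x ^ 2 / Real.log x)) ∧
    -- the case of three variables
    ((fun x : ℝ => gcdSum f 3 x - gcdConst f 3 * (x : ℂ) ^ 3)
      =O[Filter.atTop] (fun x : ℝ => x ^ 2 * Real.log (Real.log x))) ∧
    -- the case of at least four variables
    (∀ k : ℕ, 4 ≤ k →
      (fun x : ℝ => gcdSum f k x - gcdConst f k * (x : ℂ) ^ k)
        =O[Filter.atTop] (fun x : ℝ => x ^ (k - 1))) := by
  refine ⟨⟨fun k hk p hp => hf.summable_norm_primePowTerm hk hp, hf.summable_norm_localTermTwo,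
    fun k hk => hf.summable_norm_localTerm hk⟩, hf.isBigO_gcdSum_two, hf.isBigO_gcdSum_three,
    fun k hk => ?_⟩
  obtain ⟨j, rfl⟩ : ∃ j, k = j + 1 := ⟨k - 1, by omega⟩
  exact hf.isBigO_gcdSum_succ (by omega)
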